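/- Let $\mathcal X$ be a measurable space, $\mathcal Y=\{1,\dots,c\}$, and let $P$ be any probability distribution on $\mathcal X\times\mathcal Y$. Let the dataset $\mathcal D$ consist of $m\ge 1$ training samples $(\widetilde X_j,\widetilde Y_j)$ and $n\ge 1$ calibration samples $(X_i,Y_i)$, all i.i.d. with law $P$. Let $S:\mathcal X\times\mathcal Y\to\mathbb R$ be any (measurable) conformal score constructed from the training samples, let $\alpha\in[0,1]$ and $\delta\in(0,1)$, and let $w=\{w_i(y)\}$ be label weights, possibly depending on the data, with $w_i(y)\ge 0$ and $\sum_{y\in\mathcal Y} w_i(y)=1$ for $i=1,\dots,n$. Put $$\widehat q=\inf\Big\{q\in\mathbb R:\ \tfrac1n\sum_{i=1}^n\sum_{y\in\mathcal Y} w_i(y)\,\mathbb I\{S(X_i,y)\le q\}\ \ge\ (1-\alpha)\big(1+\tfrac1n\big)\Big\}\in[-\infty,+\infty],\qquad \mathcal C(x)=\{y\in\mathcal Y:\ S(x,y)\le\widehat q\,\},$$ and $\mathfrak X_{\mathcal C}(x,y)=\mathbb I\{y\in\mathcal C(x)\}$. Let $\mathcal F$ be a nonempty family of functions $f:\mathcal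 X\times\mathcal Y\to\mathbb R$ with $|f(z)-f(z')|\le B$ for all $f\in\mathcal F$ and all $z,z'$; $\mathcal F$ is assumed to be a measurable class (its members are measurable, and so are the suprema $\sup_{f\in\mathcal F}\sum_i e_i f(z_i)$ as functions of $(z_1,\dots,z_t)$, for all $t$ and real $e_1,\dots,e_t$). Suppose that almost surely $$\Phi^{\mathcal F}_{n,m}(w)=\sup_{f\in\mathcal F}\Big|\frac1n\sum_{i=1}^n\sum_{y\in\mathcal Y} w_i(y)f(X_i,y)-\frac1m\sum_{j=1}^m f(\widetilde X_j,\widetilde Y_j)\Big|\le V_{\mathrm{opt}},$$ where $V_{\mathrm{opt}}$ may depend on the data. Let $$D(\mathfrak X_{\mathcal C},\mathcal F)=\inf_{f\in\mathcal F}\frac1n\sum_{i=1}^n\sum_{y\in\mathcal Y}\big|\mathfrak X_{\mathcal C}(X_i,y)-f(X_i,y)\big|,\qquad \mathcal R_t(\mathcal F)=\mathbb E\,\sup_{f\in\mathcal F}\frac1t\sum_{i=1}^t\sigma_i f(Z_i)\in[0,\infty]$$ with $Z_1,\dots,Z_t$ i.i.d. with law $P$ and $\sigma_1,\dots,\sigma_t$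 independent uniform signs, independent of the $Z_i$, and $$G=V_{\mathrm{opt}}+D(\mathfrak X_{\mathcal C},\mathcal F)+2\big(\mathcal R_n(\mathcal F)+\mathcal R_m(\mathcal F)\big)+B\sqrt{\Big(\frac1n+\frac1m\Big)\frac{\log(2/\delta)}{2}}.$$ Then, for a test sample $(X,Y)\sim P$ independent of $\mathcal D$, with probability at least $1-\delta$ over $\mathcal D$, $$\mathbb P\{Y\in\mathcal C(X)\mid\mathcal D\}\ \ge\ 1-\alpha-G-\sqrt{\frac{\log(2/\delta)}{2n}}.$$ If, in addition, the values $S(X_i,y)$, $i=1,\dots,n$, $y\in\mathcal Y$, are almost surely pairwise distinct, then with probability at least $1-\delta$ over $\mathcal D$, $$\mathbb P\{Y\in\mathcal C(X)\mid\mathcal D\}\ \le\ 1-\alpha+\frac{2}{n+1}+G+\sqrt{\frac{\log(2/\delta)}{2n}}.$$ -/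

import Mathlib

open MeasureTheory

noncomputable section

namespace UnsupCal

/-- The `β`-quantile `inf {q ∈ ℝ : ∑ i, p i * 𝕀{s i ≤ q} ≥ β}` of the values `s i` with
probabilities `p i`. The infimum is taken in the extended reals, so that it is `+∞` when no real
`q` qualifies and `-∞` when every real `q` does. -/
def quantile {ι : Type*} [Fintype ι] (s p : ι → ℝ) (β : ℝ) : EReal :=
  sInf ((fun q : ℝ => (q : EReal)) '' {q : ℝ | β ≤ ∑ i, p i * (if s i ≤ q then 1 else 0)})

/-- Label weights for `n` instances and `c` labels: nonnegative, and adding up to one for each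
instance. -/
def IsLabelWeights {n c : ℕ} (w : Fin n → Fin c → ℝ) : Prop :=
  (∀ i y, 0 ≤ w i y) ∧ ∀ i, ∑ y, w i y = 1

section Algorithm

variable {X : Type*} {n m c : ℕ}

/-- The conformal quantile: the `(1 - α)(1 + 1/n)`-quantile of the scores `S (x i, y)` with
probabilities `w i y / n`. -/
def conformalQuantile (α : ℝ) (S : X × Fin c → ℝ) (x : Fin n → X) (w : Fin n → Fin c → ℝ) :
    EReal :=
  quantile (fun p : Fin n × Fin c => S (x p.1, p.2)) (fun p => w p.1 p.2 / n)
    ((1 - α) * (1 + 1 / n))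

/-- The set-prediction rule `C(x') = {y : S (x', y) ≤ q̂}`, with `q̂` the conformal quantile
obtained from the calibration instances `x` and the label weights `w`. -/
def predictionSet (α : ℝ) (S : X × Fin c → ℝ) (x : Fin n → X) (w : Fin n → Fin c → ℝ)
    (x' : X) : Set (Fin c) :=
  {y | (S (x', y) : EReal) ≤ conformalQuantile α S x w}

open Classical in
/-- The indicator `(x, y) ↦ 𝕀{y ∈ C(x)}` of a set-prediction rule. -/
def coverageIndicator (C : X → Set (Fin c)) (z : X × Fin c) : ℝ :=
  if z.2 ∈ C z.1 then 1 else 0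

/-- The objective
`Φ(w) = sup_{f ∈ F} |(1/n) ∑_{i,y} w_i(y) f(x_i, y) - (1/m) ∑_j f(x̃_j, ỹ_j)|`.
(For label weights `w` and `F` with bounded differences the supremum is finite.) -/
def ipmObjective (F : Set (X × Fin c → ℝ)) (train : Fin m → X × Fin c) (x : Fin n → X)
    (w : Fin n → Fin c → ℝ) : ℝ :=
  ⨆ f : F, |(1 / n : ℝ) * ∑ i, ∑ y, w i y * f.1 (x i, y)
    - (1 / m : ℝ) * ∑ j, f.1 (train j)|

/-- The approximation error `D(χ, F) = inf_{f ∈ F} (1/n) ∑_{i,y} |χ(x_i, y) - f(x_i, y)|` at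
the instances `x`. -/
def approxError (F : Set (X × Fin c → ℝ)) (x : Fin n → X) (χ : X × Fin c → ℝ) : ℝ :=
  ⨅ f : F, (1 / n : ℝ) * ∑ i, ∑ y, |χ (x i, y) - f.1 (x i, y)|

end Algorithm

section Rademacher

variable {Z : Type*}

/-- The empirical Rademacher complexity `E_σ sup_{f ∈ F} (1/t) ∑ i, σ_i f(z_i)`, where `σ` is
uniform on `{-1, 1}^t`. The supremum is taken in the extended reals. For nonempty `F` the
average over `σ` is nonnegative (it is at least the average for any single `f`, which is `0`), so
that the passage to `[0, ∞]` loses nothing. -/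
def empRademacher (F : Set (Z → ℝ)) {t : ℕ} (z : Fin t → Z) : ENNReal :=
  (∑ σ : Fin t → ℤˣ,
    ⨆ f : F, (((1 / t : ℝ) * ∑ i, ((σ i : ℤ) : ℝ) * f.1 (z i) : ℝ) : EReal)).toENNReal / 2 ^ t

/-- The Rademacher complexity of `F` for `t` i.i.d. samples with law `P`. -/
def rademacher [MeasurableSpace Z] (P : Measure Z) (F : Set (Z → ℝ)) (t : ℕ) : ENNReal :=
  ∫⁻ z : Fin t → Z, empRademacher F z ∂(Measure.pi fun _ => P)

/-- Measurable class of functions: every member is measurable, and so is every supremum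
`sup_{f ∈ F} ∑ i, e_i f(z_i)` as a function of `z`. -/
structure IsMeasurableClass [MeasurableSpace Z] (F : Set (Z → ℝ)) : Prop where
  measurable : ∀ f ∈ F, Measurable f
  measurable_sup : ∀ (t : ℕ) (e : Fin t → ℝ),
    Measurable fun z : Fin t → Z => ⨆ f : F, ((∑ i, e i * f.1 (z i) : ℝ) : EReal)

end Rademacher

section Coverage

variable {X : Type*} [MeasurableSpace X] {n m c : ℕ}

/-- The law of the dataset: `m` training samples and `n` calibration samples, all independent
with law `P`. -/
def dataLaw (P : Measure (X × Fin c)) (m n : ℕ) :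
    Measure ((Fin m → X × Fin c) × (Fin n → X × Fin c)) :=
  (Measure.pi fun _ => P).prod (Measure.pi fun _ => P)

/-- The coverage `P{Y ∈ C(X)}` of a set-prediction rule for a fresh test sample `(X, Y) ~ P`.
For a rule obtained from the dataset this is the coverage conditional on the dataset. -/
def coverage (P : Measure (X × Fin c)) (C : X → Set (Fin c)) : ℝ :=
  P.real {z | z.2 ∈ C z.1}

/-- The excess coverage gap
`G = V + D(χ, F) + 2 (R_n(F) + R_m(F)) + B √((1/n + 1/m) log(2/δ) / 2)`,
where `χ` is the coverage indicator of the rule `C`, approximated at the instances `x`.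
It is `+∞` if a Rademacher complexity is. -/
def coverageGap (P : Measure (X × Fin c)) (F : Set (X × Fin c → ℝ)) (m : ℕ) (B δ V : ℝ)
    (x : Fin n → X) (C : X → Set (Fin c)) : EReal :=
  ((V + approxError F x (coverageIndicator C)
      + B * √((1 / n + 1 / m) * (Real.log (2 / δ) / 2)) : ℝ) : EReal)
    + ((2 * (rademacher P F n + rademacher P F m) : ENNReal) : EReal)

/-- The property `Q` holds with probability at least `p`. -/
def WithProbAtLeast {Ω : Type*} [MeasurableSpace Ω] (μ : Measure Ω) (p : ℝ) (Q : Ω → Prop) :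
    Prop :=
  ∃ A : Set Ω, MeasurableSet A ∧ ENNReal.ofReal p ≤ μ A ∧ ∀ ω ∈ A, Q ω

end Coverage

end UnsupCal

end

open MeasureTheory ProbabilityTheory

namespace UnsupCal

open scoped NNReal ENNReal

/-! By the choice of the quantile, the `w`-weighted coverage of the calibration instances is at
least 1 - α and, for distinct scores, at most 1 - α + 2/(n+1). Two passages remain: from label
weights to true calibration labels, and from the calibration sample to `P`.

In the first passage the coverage indicator χ is replaced by some f in `F`. Since |w_i(y) - 𝕀{y =
Y_i}| ≤ 1, this costs at most (1/n) ∑ |χ - f|, whose infimum is the approximation error. For f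
itself, `V` compares the weighted mean with the training mean, and `meanGap` the training mean with
the calibration mean (`weighted_sub_empirical_le`, `empirical_sub_weighted_le`). `meanGap`
concentrates by McDiarmid's inequality. Its mean is at most 2(R_m + R_n): insert the population mean
and symmetrize each half against a ghost sample of its own size (`measure_meanGap_gt_le`).

In the second passage the threshold depends on the calibration sample, so the empirical distribution
function of the scores must be controlled uniformly. Given the training sample, the scores are
i.i.d., and each bound needs only one side of the Dvoretzky–Kiefer–Wolfowitz inequality. Its bound
exp(-2ne²), without prefactor, equals δ/2 for the e of the theorem; the other δ/2 is spent on
`meanGap`.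

That inequality (`measure_empirical_cdf_le`) is proved by a change of measure. Add to the law μ an
atom of mass a to the left of a finite grid. At a grid point q with μ(-∞, q] = t > 0, only the mass
below q matters, so the atom may be smeared over (-∞, q] as the density 1 + a/t. If the last
exceedance of the grid occurs at q, the product density is at least (1 + a/t)^(n(t+e)). One and the
same a makes this at least exp(2ne²)(1 + a)^n for every t (`exists_tilt`). The events "the last
exceedance is at q" are disjoint, and the enlarged product measure has total mass (1 + a)^n, so
their union has probability at most exp(-2ne²). -/

/-! ### Bernoulli relative entropy and the universal tilt. -/

/-- The odds ratio of two Bernoulli parameters at distance `e`, in logarithms. -/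
lemma four_mul_le_log_sub_log {t e : ℝ} (ht : 0 < t) (he : 0 ≤ e) (hte : t + e < 1) :
    4 * e ≤ (Real.log (t + e) - Real.log t) - (Real.log (1 - t - e) - Real.log (1 - t)) := by
  -- The derivative 1/(x(1 - x)) - 4 is nonnegative because x(1 - x) ≤ 1/4.
  let g : ℝ → ℝ := fun x => Real.log x - Real.log (1 - x) - 4 * x
  have hg : MonotoneOn g (Set.Icc t (t + e)) := by
    have hd : ∀ x ∈ Set.Icc t (t + e), HasDerivAt g (1 / x - (-1) / (1 - x) - 4) x := by
      intro x hx
      have hx0 : x ≠ 0 := by linarith [hx.1]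
      have hx1 : 1 - x ≠ 0 := by linarith [hx.2]
      have h1 := (hasDerivAt_id x).log hx0
      have h2 := ((hasDerivAt_id x).const_sub 1).log hx1
      have h3 := ((hasDerivAt_id x).const_mul 4)
      exact ((h1.sub h2).sub h3).congr_deriv (by simp)
    refine monotoneOn_of_deriv_nonneg (convex_Icc _ _)
      (fun x hx => (hd x hx).continuousAt.continuousWithinAt)
      (fun x hx => (hd x (interior_subset hx)).differentiableAt.differentiableWithinAt) ?_
    intro x hx
    have hx' := interior_subset hx
    rw [(hd x hx').deriv]
    have hx0 : 0 < x := by linarith [hx'.1]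
    have hx1 : 0 < 1 - x := by linarith [hx'.2]
    have : 1 / x - (-1) / (1 - x) - 4 = (1 - 2 * x) ^ 2 / (x * (1 - x)) := by
      field_simp
      ring
    rw [this]
    positivity
  have h := hg (Set.left_mem_Icc.2 (by linarith)) (Set.right_mem_Icc.2 (by linarith))
    (by linarith)
  simp only [g] at h
  rw [show 1 - (t + e) = 1 - t - e by ring] at h
  linarith

/-- Pinsker's inequality for Bernoulli laws. -/
lemma two_mul_sq_le_bernoulli_kl {t e : ℝ} (ht : 0 < t) (he : 0 ≤ e) (hte : t + e < 1) :
    2 * e ^ 2 ≤ (t + e) * (Real.log (t + e) - Real.log t)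
      + (1 - t - e) * (Real.log (1 - t - e) - Real.log (1 - t)) := by
  -- g vanishes at 0, and its derivative is nonnegative by the log-odds estimate
  -- `four_mul_le_log_sub_log`.
  let g : ℝ → ℝ := fun x => (t + x) * (Real.log (t + x) - Real.log t)
      + (1 - t - x) * (Real.log (1 - t - x) - Real.log (1 - t)) - 2 * x ^ 2
  have hg : MonotoneOn g (Set.Icc 0 e) := by
    have hd : ∀ x ∈ Set.Icc 0 e, HasDerivAt g ((Real.log (t + x) - Real.log t)
        - (Real.log (1 - t - x) - Real.log (1 - t)) - 4 * x) x := by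
      intro x hx
      have hx0 : t + x ≠ 0 := by linarith [hx.1]
      have hx1 : 1 - t - x ≠ 0 := by linarith [hx.2]
      have i1 := (hasDerivAt_id x).const_add t
      have i2 := (hasDerivAt_id x).const_sub (1 - t)
      have h1 := i1.mul ((i1.log hx0).sub_const (Real.log t))
      have h2 := i2.mul ((i2.log hx1).sub_const (Real.log (1 - t)))
      have h3 := ((hasDerivAt_id x).pow 2).const_mul 2
      have := (h1.add h2).sub h3
      refine this.congr_deriv ?_
      simp only [id]
      field_simp
      ring
    refine monotoneOn_of_deriv_nonneg (convex_Icc _ _)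
      (fun x hx => (hd x hx).continuousAt.continuousWithinAt)
      (fun x hx => (hd x (interior_subset hx)).differentiableAt.differentiableWithinAt) ?_
    intro x hx
    have hx' := interior_subset hx
    rw [(hd x hx').deriv]
    linarith [four_mul_le_log_sub_log ht hx'.1 (by linarith [hx'.2])]
  have h := hg (Set.left_mem_Icc.2 he) (Set.right_mem_Icc.2 he) he
  simp only [g] at h
  simp at h
  linarith

/-- The parameter at which the relative entropy of the Bernoulli law with parameter `t + e`
with respect to that with parameter `t` is stationary. -/
lemma exists_stationary {e : ℝ} (he : 0 < e) (he1 : e < 1) :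
    ∃ t, 0 < t ∧ t + e < 1 ∧
      (Real.log (t + e) - Real.log t) - (Real.log (1 - t - e) - Real.log (1 - t))
        = e / (t * (1 - t)) := by
  let h : ℝ → ℝ := fun t => (Real.log (t + e) - Real.log t)
      - (Real.log (1 - t - e) - Real.log (1 - t)) - e / (t * (1 - t))
  -- The intermediate value theorem is applied between the symmetric point (1 - e)/2 and 1 - e - η.
  -- Here η is so small that -log η outweighs the term e/(t(1 - t)), which is at most 2/(1 - e) at
  -- the right end.
  obtain ⟨η, hη0, hη1, hη2⟩ : ∃ η, 0 < η ∧ η ≤ (1 - e) / 2 ∧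
      Real.log η ≤ Real.log e - 2 / (1 - e) := by
    refine ⟨min ((1 - e) / 2) (e * Real.exp (-(2 / (1 - e)))), ?_, min_le_left _ _, ?_⟩
    · have : 0 < (1 - e) / 2 := by linarith
      positivity
    · have : 0 < (1 - e) / 2 := by linarith
      calc _ ≤ Real.log (e * Real.exp (-(2 / (1 - e)))) :=
            Real.log_le_log (by positivity) (min_le_right _ _)
        _ = _ := by rw [Real.log_mul he.ne' (Real.exp_pos _).ne', Real.log_exp]; ring
  -- At t = (1 - e)/2 one has t + e = 1 - t, so the claim reduces to log((1 + e)/(1 - e)) ≤ 2e/(1 -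
  -- e²).
  have hlo : h ((1 - e) / 2) ≤ 0 := by
    have key : Real.log (1 + e) - Real.log (1 - e) ≤ 2 * e / (1 - e ^ 2) := by
      let g : ℝ → ℝ := fun x => 2 * x / (1 - x ^ 2) - (Real.log (1 + x) - Real.log (1 - x))
      have hg : MonotoneOn g (Set.Icc 0 e) := by
        have hd : ∀ x ∈ Set.Icc 0 e, HasDerivAt g
            ((2 * (1 - x ^ 2) - 2 * x * (-(2 * x))) / (1 - x ^ 2) ^ 2
              - (1 / (1 + x) - (-1) / (1 - x))) x := by
          intro x hx
          have hx0 : 1 + x ≠ 0 := by linarith [hx.1]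
          have hx1 : 1 - x ≠ 0 := by linarith [hx.2]
          have hx2 : 1 - x ^ 2 ≠ 0 := by
            rw [show 1 - x ^ 2 = (1 + x) * (1 - x) by ring]
            exact mul_ne_zero hx0 hx1
          have h1 := (((hasDerivAt_id x).const_add 1).log hx0).sub
            (((hasDerivAt_id x).const_sub 1).log hx1)
          have h2 := ((hasDerivAt_id x).const_mul 2).div
            (((hasDerivAt_id x).pow 2).const_sub 1) hx2
          exact (h2.sub h1).congr_deriv (by simp)
        refine monotoneOn_of_deriv_nonneg (convex_Icc _ _)
          (fun x hx => (hd x hx).continuousAt.continuousWithinAt)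
          (fun x hx => (hd x (interior_subset hx)).differentiableAt.differentiableWithinAt) ?_
        intro x hx
        have hx' := interior_subset hx
        rw [(hd x hx').deriv]
        have hx0 : 0 < 1 + x := by linarith [hx'.1]
        have hx1 : 0 < 1 - x := by linarith [hx'.2]
        have hx2 : 1 - x ^ 2 = (1 + x) * (1 - x) := by ring
        have : (2 * (1 - x ^ 2) - 2 * x * (-(2 * x))) / (1 - x ^ 2) ^ 2
              - (1 / (1 + x) - (-1) / (1 - x)) = 4 * x ^ 2 / ((1 + x) * (1 - x)) ^ 2 := by
          rw [hx2]
          field_simp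
          ring
        rw [this]
        positivity
      have h := hg (Set.left_mem_Icc.2 he.le) (Set.right_mem_Icc.2 he.le) he.le
      simp only [g] at h
      simp at h
      linarith
    have e1 : (1 - e) / 2 + e = (1 + e) / 2 := by ring
    have e2 : 1 - (1 - e) / 2 = (1 + e) / 2 := by ring
    have e3 : (1 + e) / 2 - e = (1 - e) / 2 := by ring
    have e4 : e / ((1 - e) / 2 * ((1 + e) / 2)) = 2 * (2 * e / (1 - e ^ 2)) := by
      rw [show 1 - e ^ 2 = (1 - e) * (1 + e) by ring]
      have : 1 - e ≠ 0 := by linarith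
      field_simp
    simp only [h, e1, e2, e3, e4]
    rw [Real.log_div (by linarith) two_ne_zero, Real.log_div (by linarith) two_ne_zero]
    linarith
  have hhi : 0 ≤ h (1 - e - η) := by
    have t1 : (1 - e) / 2 ≤ 1 - e - η := by linarith
    have t0 : 0 < 1 - e - η := by linarith
    have hp : 0 < (1 - e - η) * (1 - (1 - e - η)) := mul_pos t0 (by linarith)
    have l1 : Real.log (1 - e - η) ≤ Real.log (1 - e - η + e) := Real.log_le_log t0 (by linarith)
    have l2 : Real.log e ≤ Real.log (1 - (1 - e - η)) := Real.log_le_log he (by linarith)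
    have l3 : e / ((1 - e - η) * (1 - (1 - e - η))) ≤ 2 / (1 - e) := by
      rw [div_le_div_iff₀ hp (by linarith)]
      have : (1 - e) / 2 * e ≤ (1 - e - η) * (1 - (1 - e - η)) :=
        mul_le_mul t1 (by linarith) he.le t0.le
      linarith
    simp only [h]
    rw [show 1 - (1 - e - η) - e = η by ring]
    linarith
  have hc : ContinuousOn h (Set.Icc ((1 - e) / 2) (1 - e - η)) := by
    intro x hx
    have h0 : x ≠ 0 := by linarith [hx.1]
    have h1 : x + e ≠ 0 := by linarith [hx.1]
    have h2 : 1 - x ≠ 0 := by linarith [hx.2]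
    have h3 : 1 - x - e ≠ 0 := by linarith [hx.2]
    have h4 : x * (1 - x) ≠ 0 := mul_ne_zero h0 h2
    apply ContinuousAt.continuousWithinAt
    simp only [h]
    fun_prop (disch := assumption)
  obtain ⟨t, ht, hht⟩ := intermediate_value_Icc (by linarith) hc ⟨hlo, hhi⟩
  refine ⟨t, by linarith [ht.1], by linarith [ht.2], ?_⟩
  simp only [h] at hht
  linarith

/-- A single tilt that certifies the sub-Gaussian rate `2 e ^ 2` at all levels `t`. -/
lemma exists_tilt {e : ℝ} (he : 0 < e) (he1 : e < 1) :
    ∃ a : ℝ, 0 < a ∧ ∀ t, 0 < t →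
      2 * e ^ 2 ≤ (t + e) * Real.log (1 + a / t) - Real.log (1 + a) := by
  obtain ⟨s, hs0, hs1, hs⟩ := exists_stationary he he1
  have hse : 0 < 1 - s - e := by linarith
  have hs1' : 0 < 1 - s := by linarith
  -- This makes 1 + a/s the odds ratio of s + e and s, so that at t = s the right-hand side is
  -- exactly the relative entropy. Stationarity of s makes s the minimizer over t.
  set a := e / (1 - s - e) with ha
  have ha0 : 0 < a := div_pos he hse
  have ha1 : Real.log (1 + a) = Real.log (1 - s) - Real.log (1 - s - e) := by
    rw [← Real.log_div hs1'.ne' hse.ne', ha]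
    congr 1
    field_simp
    ring
  have ha2 : Real.log (1 + a / s) = e / (s * (1 - s)) := by
    rw [← hs, show 1 + a / s = ((s + e) / s) / ((1 - s - e) / (1 - s)) by
      rw [ha]; field_simp; ring, Real.log_div (by positivity) (by positivity),
      Real.log_div (by positivity) (by positivity), Real.log_div (by positivity) (by positivity)]
  refine ⟨a, ha0, ?_⟩
  let f : ℝ → ℝ := fun t => (t + e) * Real.log (1 + a / t)
  -- ζ carries the sign of f'. It increases because log(1 + x) ≥ 2x/(x + 2), and it vanishes at s,
  -- so f is minimal there.
  let ζ : ℝ → ℝ := fun t => t * (t + a) / a * Real.log (1 + a / t) - (t + e)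
  have hlog : ∀ t, 0 < t → HasDerivAt (fun t => Real.log (1 + a / t)) (-(a / (t * (t + a)))) t := by
    intro t ht
    have h1 := ((hasDerivAt_inv ht.ne').const_mul a).const_add 1
    have h2 := h1.log (by positivity)
    refine (h2.congr_deriv ?_)
    field_simp
  have hfd : ∀ t, 0 < t → HasDerivAt f (a / (t * (t + a)) * ζ t) t := by
    intro t ht
    refine (((hasDerivAt_id t).add_const e).mul (hlog t ht)).congr_deriv ?_
    simp only [ζ, id]
    field_simp
    ring
  have hζd : ∀ t, 0 < t → HasDerivAt ζ ((2 * t + a) / a * Real.log (1 + a / t) - 2) t := by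
    intro t ht
    have h1 := (((hasDerivAt_id t).mul ((hasDerivAt_id t).add_const a)).div_const a).mul (hlog t ht)
    refine (h1.sub ((hasDerivAt_id t).add_const e)).congr_deriv ?_
    simp only [id, Pi.mul_apply]
    field_simp
    ring
  have hζm : MonotoneOn ζ (Set.Ioi 0) := by
    refine monotoneOn_of_deriv_nonneg (convex_Ioi _)
      (fun x hx => (hζd x hx).continuousAt.continuousWithinAt)
      (fun x hx => (hζd x (interior_subset hx)).differentiableAt.differentiableWithinAt) ?_
    intro t ht
    have ht : 0 < t := interior_subset ht
    rw [(hζd t ht).deriv]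
    have h1 := Real.le_log_one_add_of_nonneg (x := a / t) (by positivity)
    have h2 : (2 * t + a) / a * (2 * (a / t) / (a / t + 2)) = 2 := by
      field_simp
      ring
    have h3 := mul_le_mul_of_nonneg_left h1 (by positivity : 0 ≤ (2 * t + a) / a)
    linarith
  have hζs : ζ s = 0 := by
    simp only [ζ, ha2]
    rw [ha]
    field_simp
    ring
  have hfs : 2 * e ^ 2 ≤ f s - Real.log (1 + a) := by
    have h := two_mul_sq_le_bernoulli_kl hs0 he.le hs1
    simp only [f]
    rw [ha1, ha2, ← hs]
    linarith
  have hmin : ∀ t, 0 < t → f s ≤ f t := by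
    intro t ht
    rcases le_total s t with hst | hst
    · have : MonotoneOn f (Set.Icc s t) := by
        have hp : ∀ x ∈ Set.Icc s t, 0 < x := fun x hx => lt_of_lt_of_le hs0 hx.1
        refine monotoneOn_of_deriv_nonneg (convex_Icc _ _)
          (fun x hx => (hfd x (hp x hx)).continuousAt.continuousWithinAt)
          (fun x hx => (hfd x (hp x (interior_subset hx))).differentiableAt.differentiableWithinAt)
          fun x hx => ?_
        have hx' := interior_subset hx
        have hx0 := hp x hx'
        rw [(hfd x hx0).deriv]
        have : 0 ≤ ζ x := hζs ▸ hζm hs0 hx0 hx'.1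
        positivity
      exact this (Set.left_mem_Icc.2 hst) (Set.right_mem_Icc.2 hst) hst
    · have : AntitoneOn f (Set.Icc t s) := by
        have hp : ∀ x ∈ Set.Icc t s, 0 < x := fun x hx => lt_of_lt_of_le ht hx.1
        refine antitoneOn_of_deriv_nonpos (convex_Icc _ _)
          (fun x hx => (hfd x (hp x hx)).continuousAt.continuousWithinAt)
          (fun x hx => (hfd x (hp x (interior_subset hx))).differentiableAt.differentiableWithinAt)
          fun x hx => ?_
        have hx' := interior_subset hx
        have hx0 := hp x hx'
        rw [(hfd x hx0).deriv]
        have : ζ x ≤ 0 := hζs ▸ hζm hx0 hs0 hx'.2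
        exact mul_nonpos_of_nonneg_of_nonpos (by positivity) this
      exact this (Set.left_mem_Icc.2 hst) (Set.right_mem_Icc.2 hst) hst
  intro t ht
  have := hmin t ht
  simp only [f] at this hfs
  linarith

/-! ### Change of measure: an added atom and its smeared version. -/

lemma pi_withDensity {ι Ω : Type*} [Fintype ι] [MeasurableSpace Ω] (μ : Measure Ω)
    [IsProbabilityMeasure μ] {f : Ω → ℝ≥0∞} (hf : Measurable f) [SigmaFinite (μ.withDensity f)] :
    Measure.pi (fun _ : ι => μ.withDensity f)
      = (Measure.pi fun _ : ι => μ).withDensity fun x => ∏ i, f (x i) := by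
  refine Measure.pi_eq fun s hs => ?_
  have hind : ∀ x : ι → Ω, (Set.univ.pi s).indicator (fun x => ∏ i, f (x i)) x
      = ∏ i, (s i).indicator f (x i) := by
    intro x
    by_cases hx : x ∈ Set.univ.pi s
    · rw [Set.indicator_of_mem hx]
      exact Finset.prod_congr rfl fun i _ => (Set.indicator_of_mem (hx i trivial) f).symm
    · rw [Set.indicator_of_notMem hx]
      simp only [Set.mem_pi, Set.mem_univ, true_imp_iff, not_forall] at hx
      obtain ⟨i, hi⟩ := hx
      exact (Finset.prod_eq_zero (Finset.mem_univ i) (Set.indicator_of_notMem hi f)).symm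
  have hm : ∀ i, Measurable ((s i).indicator f) := fun i => hf.indicator (hs i)
  have hI := iIndepFun_pi (μ := fun _ : ι => μ) (X := fun i => (s i).indicator f)
    fun i => (hm i).aemeasurable
  have hmp : MeasurableSet (Set.univ.pi s) := MeasurableSet.univ_pi hs
  rw [withDensity_apply _ hmp, ← lintegral_indicator hmp]
  simp_rw [hind]
  rw [lintegral_prod_eq_prod_lintegral_of_indepFun _ _ hI
    fun i => (hm i).comp (measurable_pi_apply i)]
  refine Finset.prod_congr rfl fun i _ => ?_
  rw [withDensity_apply _ (hs i), ← lintegral_indicator (hs i)]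
  exact (measurePreserving_eval (fun _ : ι => μ) i).lintegral_comp (hm i)

section Tilt

variable (μ : Measure ℝ) (a b q : ℝ)

/-- The law `μ` with an additional atom of mass `a` at `b`. -/
noncomputable def addAtom : Measure ℝ := μ + ENNReal.ofReal a • Measure.dirac b

instance [IsFiniteMeasure μ] : IsFiniteMeasure (addAtom μ a b) := by
  unfold addAtom
  have : IsFiniteMeasure (ENNReal.ofReal a • Measure.dirac b) :=
    Measure.smul_finite _ ENNReal.ofReal_ne_top
  infer_instance

/-- The density that spreads an atom of mass `a` over the half-line below `q`. -/
noncomputable def tiltDensity (s : ℝ) : ℝ≥0∞ :=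
  1 + (Set.Iic q).indicator (fun _ => ENNReal.ofReal (a / μ.real (Set.Iic q))) s

lemma measurable_tiltDensity : Measurable (tiltDensity μ a q) := by
  unfold tiltDensity
  exact Measurable.const_add (measurable_const.indicator measurableSet_Iic) _

/-- Both laws add mass a to `μ` on the half-line up to q, and `max q` collapses that half-line to a
point. One law of added atom thus serves all q ≥ b. -/
lemma map_max_tilt [IsProbabilityMeasure μ] {a b q : ℝ} (ha : 0 ≤ a) (hb : b ≤ q) (hq : 0 < μ.real (Set.Iic q)) :
    (μ.withDensity (tiltDensity μ a q)).map (max q) = (addAtom μ a b).map (max q) := by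
  have hm : Measurable (max q : ℝ → ℝ) := measurable_const.max measurable_id
  ext B hB
  have hB' : MeasurableSet (max q ⁻¹' B) := hm hB
  rw [Measure.map_apply hm hB, Measure.map_apply hm hB, withDensity_apply _ hB']
  simp only [tiltDensity, addAtom]
  rw [lintegral_add_left measurable_const, lintegral_indicator measurableSet_Iic]
  simp only [lintegral_const, Measure.restrict_apply MeasurableSet.univ, Set.univ_inter, one_mul,
    Measure.add_apply, Measure.smul_apply, smul_eq_mul, Measure.dirac_apply' _ hB']
  rw [Measure.restrict_apply measurableSet_Iic]
  congr 1
  by_cases hqB : q ∈ B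
  · have h1 : Set.Iic q ∩ max q ⁻¹' B = Set.Iic q := by
      refine Set.inter_eq_left.2 fun x hx => ?_
      simpa [max_eq_left (Set.mem_Iic.1 hx)] using hqB
    have h2 : b ∈ max q ⁻¹' B := by simpa [max_eq_left hb] using hqB
    rw [h1, Set.indicator_of_mem h2, ← ofReal_measureReal,
      ← ENNReal.ofReal_mul (div_nonneg ha hq.le), div_mul_cancel₀ _ hq.ne']
    simp
  · have h1 : Set.Iic q ∩ max q ⁻¹' B = ∅ := by
      refine Set.eq_empty_of_forall_notMem fun x hx => hqB ?_
      simpa [max_eq_left (Set.mem_Iic.1 hx.1)] using hx.2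
    have h2 : b ∉ max q ⁻¹' B := by simpa [max_eq_left hb] using hqB
    rw [h1, Set.indicator_of_notMem h2]
    simp

lemma pi_tilt_apply [IsProbabilityMeasure μ] {a b q : ℝ} (ha : 0 ≤ a) (hb : b ≤ q) (hq : 0 < μ.real (Set.Iic q)) {n : ℕ}
    {E : Set (Fin n → ℝ)} (hE : MeasurableSet E)
    (hEq : (fun s : Fin n → ℝ => fun i => max q (s i)) ⁻¹' E = E) :
    ∫⁻ s in E, ∏ i, tiltDensity μ a q (s i) ∂(Measure.pi fun _ : Fin n => μ)
      = (Measure.pi fun _ : Fin n => addAtom μ a b) E := by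
  have hm : Measurable (max q : ℝ → ℝ) := measurable_const.max measurable_id
  have hfin : IsFiniteMeasure (μ.withDensity (tiltDensity μ a q)) := by
    refine isFiniteMeasure_withDensity (ne_of_lt ?_)
    calc ∫⁻ s, tiltDensity μ a q s ∂μ
        ≤ ∫⁻ _, (1 + ENNReal.ofReal (a / μ.real (Set.Iic q))) ∂μ := by
          refine lintegral_mono fun s => ?_
          unfold tiltDensity
          gcongr
          exact Set.indicator_le_self' (fun _ _ => zero_le) s
      _ < ∞ := by simp [ENNReal.add_lt_top]
  have hM : Measurable (fun s : Fin n → ℝ => fun i => max q (s i)) :=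
    measurable_pi_lambda _ fun i => hm.comp (measurable_pi_apply i)
  have h1 := Measure.pi_map_pi (μ := fun _ : Fin n => μ.withDensity (tiltDensity μ a q))
    (f := fun _ => max q) fun _ => hm.aemeasurable
  have h2 := Measure.pi_map_pi (μ := fun _ : Fin n => addAtom μ a b)
    (f := fun _ => max q) fun _ => hm.aemeasurable
  rw [← withDensity_apply _ hE, ← pi_withDensity μ (measurable_tiltDensity μ a q)]
  conv_lhs => rw [← hEq, ← Measure.map_apply hM hE, h1]
  conv_rhs => rw [← hEq, ← Measure.map_apply hM hE, h2]
  simp_rw [map_max_tilt μ ha hb hq]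

end Tilt

/-! ### The one-sided Dvoretzky–Kiefer–Wolfowitz inequality. -/

/-- The number of coordinates not exceeding `q`. -/
noncomputable def countLE {n : ℕ} (s : Fin n → ℝ) (q : ℝ) : ℝ := ∑ i, if s i ≤ q then 1 else 0

lemma measurable_countLE {n : ℕ} (q : ℝ) : Measurable fun s : Fin n → ℝ => countLE s q := by
  unfold countLE
  exact Finset.measurable_sum _ fun i _ => Measurable.ite
    (measurableSet_le (measurable_pi_apply i) measurable_const) measurable_const measurable_const

lemma countLE_le {n : ℕ} (s : Fin n → ℝ) (q : ℝ) : countLE s q ≤ n := by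
  calc countLE s q ≤ ∑ _i : Fin n, (1 : ℝ) :=
        Finset.sum_le_sum fun i _ => by split_ifs <;> norm_num
    _ = n := by simp

lemma countLE_max {n : ℕ} (s : Fin n → ℝ) {q r : ℝ} (h : q ≤ r) :
    countLE (fun i => max q (s i)) r = countLE s r := by
  simp [countLE, h]

/-- The product equals (1 + a/t) to the power `countLE s q`, and this exponent is at least n(t + e).
-/
lemma exp_mul_le_prod_tiltDensity (μ : Measure ℝ) {n : ℕ} {a e q : ℝ} (ha : 0 < a)
    (h : ∀ t, 0 < t → 2 * e ^ 2 ≤ (t + e) * Real.log (1 + a / t) - Real.log (1 + a))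
    (hq : 0 < μ.real (Set.Iic q)) {s : Fin n → ℝ} (hs : n * (μ.real (Set.Iic q) + e) ≤ countLE s q) :
    ENNReal.ofReal (Real.exp (2 * n * e ^ 2) * (1 + a) ^ n) ≤ ∏ i, tiltDensity μ a q (s i) := by
  set t := μ.real (Set.Iic q) with ht
  have hl : 0 ≤ Real.log (1 + a / t) :=
    Real.log_nonneg (by have : 0 < a / t := by positivity
                        linarith)
  have h1 : ∀ i, tiltDensity μ a q (s i)
      = ENNReal.ofReal (Real.exp (Real.log (1 + a / t) * (if s i ≤ q then 1 else 0))) := by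
    intro i
    unfold tiltDensity
    by_cases hi : s i ≤ q
    · rw [Set.indicator_of_mem (Set.mem_Iic.2 hi), if_pos hi, mul_one,
        Real.exp_log (by positivity), ENNReal.ofReal_add zero_le_one (by positivity),
        ENNReal.ofReal_one]
    · rw [Set.indicator_of_notMem (by simpa using hi), if_neg hi]
      simp
  simp_rw [h1]
  rw [← ENNReal.ofReal_prod_of_nonneg fun i _ => (Real.exp_pos _).le, ← Real.exp_sum,
    ← Finset.mul_sum]
  apply ENNReal.ofReal_le_ofReal
  have h2 : (1 + a) ^ n = Real.exp (n * Real.log (1 + a)) := by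
    rw [Real.exp_nat_mul, Real.exp_log (by positivity)]
  rw [h2, ← Real.exp_add, Real.exp_le_exp]
  have h3 := mul_le_mul_of_nonneg_left (h t hq) (Nat.cast_nonneg (α := ℝ) n)
  have h4 := mul_le_mul_of_nonneg_left hs hl
  change _ ≤ Real.log (1 + a / t) * countLE s q
  nlinarith

/-- A maximal inequality for the empirical distribution function on a finite grid. -/
lemma measure_grid_le (μ : Measure ℝ) [IsProbabilityMeasure μ] {n : ℕ} {e : ℝ} (he : 0 < e) (he1 : e < 1) (T : Finset ℝ)
    (hT : ∀ q ∈ T, 0 < μ.real (Set.Iic q)) :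
    (Measure.pi fun _ : Fin n => μ) {s | ∃ q ∈ T, n * (μ.real (Set.Iic q) + e) ≤ countLE s q}
      ≤ ENNReal.ofReal (Real.exp (-(2 * n * e ^ 2))) := by
  classical
  obtain ⟨a, ha, hat⟩ := exists_tilt he he1
  obtain ⟨b, hb⟩ : ∃ b, ∀ q ∈ T, b ≤ q := by
    obtain ⟨b, hb⟩ := T.finite_toSet.bddBelow
    exact ⟨b, fun q hq => hb hq⟩
  let E : ℝ → Set (Fin n → ℝ) := fun q => {s | n * (μ.real (Set.Iic q) + e) ≤ countLE s q}
  have hEm : ∀ q, MeasurableSet (E q) :=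
    fun q => measurableSet_le measurable_const (measurable_countLE q)
  -- q is the largest grid point of exceedance. Taking the last one rather than the first makes the
  -- event depend only on counts at thresholds r ≥ q, hence invariant under truncation by `max q`.
  let J : ℝ → Set (Fin n → ℝ) := fun q => E q ∩ ⋂ r ∈ T.filter (q < ·), (E r)ᶜ
  have hJm : ∀ q, MeasurableSet (J q) := fun q =>
    (hEm q).inter (Finset.measurableSet_biInter _ fun r _ => (hEm r).compl)
  have hmax : ∀ q r, q ≤ r → ∀ s : Fin n → ℝ, (fun i => max q (s i)) ∈ E r ↔ s ∈ E r := by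
    intro q r hqr s
    simp only [E, Set.mem_ofPred_eq, countLE_max s hqr]
  have hJq : ∀ q, (fun s : Fin n → ℝ => fun i => max q (s i)) ⁻¹' (J q) = J q := by
    intro q
    ext s
    simp only [J, Set.mem_preimage, Set.mem_inter_iff, Set.mem_iInter, Set.mem_compl_iff,
      hmax q q le_rfl]
    refine and_congr_right fun _ => forall_congr' fun r => forall_congr' fun hr => ?_
    rw [hmax q r (Finset.mem_filter.1 hr).2.le]
  have hdisj : Set.PairwiseDisjoint (T : Set ℝ) J := by
    have key : ∀ q ∈ T, ∀ r ∈ T, q < r → Disjoint (J q) (J r) := by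
      intro q _ r hr hqr
      refine Set.disjoint_left.2 fun s hs hs' => ?_
      have := Set.mem_iInter₂.1 hs.2 r (Finset.mem_filter.2 ⟨hr, hqr⟩)
      exact this hs'.1
    intro q hq r hr hqr
    rcases lt_or_gt_of_ne hqr with h | h
    · exact key q hq r hr h
    · exact (key r hr q hq h).symm
  have hcover : {s | ∃ q ∈ T, n * (μ.real (Set.Iic q) + e) ≤ countLE s q} ⊆ ⋃ q ∈ T, J q := by
    rintro s ⟨q, hq, hs⟩
    have hne : (T.filter fun r => s ∈ E r).Nonempty := ⟨q, Finset.mem_filter.2 ⟨hq, hs⟩⟩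
    have hmem := Finset.mem_filter.1 (Finset.max'_mem _ hne)
    refine Set.mem_iUnion₂.2 ⟨_, hmem.1, hmem.2, Set.mem_iInter₂.2 fun r hr hrs => ?_⟩
    rw [Finset.mem_filter] at hr
    exact absurd (Finset.le_max' _ r (Finset.mem_filter.2 ⟨hr.1, hrs⟩)) (not_le.2 hr.2)
  set K := ENNReal.ofReal (Real.exp (2 * n * e ^ 2) * (1 + a) ^ n) with hK
  have hJ : ∀ q ∈ T, K * (Measure.pi fun _ : Fin n => μ) (J q)
      ≤ (Measure.pi fun _ : Fin n => addAtom μ a b) (J q) := by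
    intro q hq
    rw [← pi_tilt_apply μ ha.le (hb q hq) (hT q hq) (hJm q) (hJq q)]
    rw [← setLIntegral_const]
    exact setLIntegral_mono' (hJm q) fun s hs =>
      exp_mul_le_prod_tiltDensity μ ha hat (hT q hq) hs.1
  have htot : (Measure.pi fun _ : Fin n => addAtom μ a b) Set.univ
      = ENNReal.ofReal ((1 + a) ^ n) := by
    rw [Measure.pi_univ]
    simp only [addAtom, Measure.add_apply, measure_univ, Measure.smul_apply, smul_eq_mul, mul_one,
      Finset.prod_const, Finset.card_univ, Fintype.card_fin]
    rw [ENNReal.ofReal_pow (by positivity), ENNReal.ofReal_add zero_le_one ha.le,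
      ENNReal.ofReal_one]
  have hmain : K * (Measure.pi fun _ : Fin n => μ)
      {s | ∃ q ∈ T, n * (μ.real (Set.Iic q) + e) ≤ countLE s q} ≤ ENNReal.ofReal ((1 + a) ^ n) :=
    calc _ ≤ K * ∑ q ∈ T, (Measure.pi fun _ : Fin n => μ) (J q) := by
          gcongr
          exact (measure_mono hcover).trans (measure_biUnion_finset_le _ _)
      _ = ∑ q ∈ T, K * (Measure.pi fun _ : Fin n => μ) (J q) := Finset.mul_sum _ _ _
      _ ≤ ∑ q ∈ T, (Measure.pi fun _ : Fin n => addAtom μ a b) (J q) := Finset.sum_le_sum hJ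
      _ = (Measure.pi fun _ : Fin n => addAtom μ a b) (⋃ q ∈ T, J q) :=
          (measure_biUnion_finset hdisj fun q _ => hJm q).symm
      _ ≤ _ := htot ▸ measure_mono (Set.subset_univ _)
  have hK0 : K ≠ 0 := by
    rw [hK, Ne, ENNReal.ofReal_eq_zero, not_le]
    positivity
  rw [mul_comm, ← ENNReal.le_div_iff_mul_le (Or.inl hK0) (Or.inl ENNReal.ofReal_ne_top)] at hmain
  refine hmain.trans_eq ?_
  rw [hK, ← ENNReal.ofReal_div_of_pos (by positivity), Real.exp_neg]
  congr 1
  field_simp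

/-- The one-sided **Dvoretzky–Kiefer–Wolfowitz inequality** with Massart's constant. -/
theorem measure_empirical_cdf_le (μ : Measure ℝ) [IsProbabilityMeasure μ] (n : ℕ) {e : ℝ}
    (he : 0 < e) :
    (Measure.pi fun _ : Fin n => μ)
      {s | ∃ q : ℚ, n * (μ.real (Set.Iic (q : ℝ)) + e) < countLE s q}
      ≤ ENNReal.ofReal (Real.exp (-(2 * n * e ^ 2))) := by
  classical
  rcases le_or_gt 1 e with he1 | he1
  · have : {s : Fin n → ℝ | ∃ q : ℚ, n * (μ.real (Set.Iic (q : ℝ)) + e) < countLE s q} = ∅ := by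
      refine Set.eq_empty_of_forall_notMem ?_
      rintro s ⟨q, hq⟩
      have h1 := countLE_le s q
      have h2 : (n : ℝ) * 1 ≤ n * (μ.real (Set.Iic (q : ℝ)) + e) := by
        gcongr
        linarith [measureReal_nonneg (μ := μ) (s := Set.Iic (q : ℝ))]
      linarith
    rw [this, measure_empty]
    exact zero_le
  let I := {q : ℚ // 0 < μ.real (Set.Iic (q : ℝ))}
  let E : ℝ → Set (Fin n → ℝ) := fun q => {s | n * (μ.real (Set.Iic q) + e) ≤ countLE s q}
  let U : Finset I → Set (Fin n → ℝ) := fun T => ⋃ q ∈ T, E (q.1 : ℝ)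
  have hU : ∀ T, (Measure.pi fun _ : Fin n => μ) (U T)
      ≤ ENNReal.ofReal (Real.exp (-(2 * n * e ^ 2))) := by
    intro T
    refine le_trans (measure_mono ?_) (measure_grid_le μ he he1 (T.image fun q => (q.1 : ℝ)) ?_)
    · intro s hs
      obtain ⟨q, hq, hs⟩ := Set.mem_iUnion₂.1 hs
      exact ⟨_, Finset.mem_image_of_mem _ hq, hs⟩
    · intro q hq
      obtain ⟨r, _, rfl⟩ := Finset.mem_image.1 hq
      exact r.2
  have hdir : Directed (· ⊆ ·) U := by
    intro T T'
    exact ⟨T ∪ T', Set.biUnion_subset_biUnion_left Finset.subset_union_left,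
      Set.biUnion_subset_biUnion_left Finset.subset_union_right⟩
  -- The tilt divides by the mass below q. Thresholds with no mass below them are discarded, since
  -- almost surely no sample point lies there.
  have hnull : (Measure.pi fun _ : Fin n => μ)
      (⋃ q : ℚ, ⋃ _ : μ.real (Set.Iic (q : ℝ)) = 0, ⋃ i, Function.eval i ⁻¹' Set.Iic (q : ℝ))
        = 0 := by
    refine measure_iUnion_null fun q => measure_iUnion_null fun hq => measure_iUnion_null fun i => ?_
    rw [(measurePreserving_eval (fun _ : Fin n => μ) i).measure_preimage
      measurableSet_Iic.nullMeasurableSet]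
    exact (measureReal_eq_zero_iff).1 hq
  calc _ ≤ (Measure.pi fun _ : Fin n => μ) ((⋃ T, U T) ∪
        (⋃ q : ℚ, ⋃ _ : μ.real (Set.Iic (q : ℝ)) = 0,
          ⋃ i, Function.eval i ⁻¹' Set.Iic (q : ℝ))) := by
        refine measure_mono ?_
        rintro s ⟨q, hq⟩
        rcases (measureReal_nonneg (μ := μ) (s := Set.Iic (q : ℝ))).eq_or_lt with h | h
        · right
          refine Set.mem_iUnion.2 ⟨q, Set.mem_iUnion.2 ⟨h.symm, ?_⟩⟩
          by_contra hcon
          simp only [Set.mem_iUnion, Set.mem_preimage, Function.eval, Set.mem_Iic, not_exists]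
            at hcon
          have : countLE s q = 0 := by simp [countLE, hcon]
          rw [this, ← h] at hq
          have : (0 : ℝ) ≤ n * (0 + e) := by positivity
          linarith
        · left
          exact Set.mem_iUnion.2 ⟨{⟨q, h⟩}, by simpa [U, E] using hq.le⟩
    _ ≤ (Measure.pi fun _ : Fin n => μ) (⋃ T, U T) + 0 := by
        rw [← hnull]
        exact measure_union_le _ _
    _ ≤ _ := by
        -- The grid bound does not depend on the grid, so it survives the directed union over finite
        -- sets of rationals.
        rw [add_zero, hdir.measure_iUnion]
        exact iSup_le hU

/-! ### McDiarmid's inequality by tensorizing sub-Gaussian bounds. -/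

section McDiarmid

variable {Ω Ω' : Type*} [MeasurableSpace Ω] [MeasurableSpace Ω']

lemma integrable_of_abs_le {μ : Measure Ω} [IsFiniteMeasure μ] {g : Ω → ℝ} (hg : Measurable g)
    {M : ℝ} (hM : ∀ x, |g x| ≤ M) : Integrable g μ :=
  Integrable.of_bound hg.aestronglyMeasurable M (Filter.Eventually.of_forall hM)

lemma abs_integral_le {μ : Measure Ω} [IsProbabilityMeasure μ] {g : Ω → ℝ} {M : ℝ}
    (hM : ∀ x, |g x| ≤ M) : |∫ x, g x ∂μ| ≤ M := by
  simpa using norm_integral_le_of_norm_le_const (μ := μ) (f := g) (C := M)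
    (Filter.Eventually.of_forall hM)

/-- A function of oscillation at most `c` is sub-Gaussian around its mean. -/
lemma hasSubgaussianMGF_of_oscillation (μ : Measure Ω) [IsProbabilityMeasure μ] {g : Ω → ℝ}
    (hg : Measurable g) {c : ℝ≥0} (hc : ∀ x y, |g x - g y| ≤ c) :
    HasSubgaussianMGF (fun x => g x - ∫ y, g y ∂μ) ((c / 2) ^ 2) μ := by
  have hne : Nonempty Ω := μ.nonempty_of_neZero
  have hbdd : BddBelow (Set.range g) := by
    obtain ⟨x₀⟩ := hne
    refine ⟨g x₀ - c, ?_⟩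
    rintro _ ⟨x, rfl⟩
    linarith [(abs_le.1 (hc x₀ x)).2]
  have h := hasSubgaussianMGF_of_mem_Icc (μ := μ) (a := ⨅ x, g x) (b := (⨅ x, g x) + c)
    hg.aemeasurable (Filter.Eventually.of_forall fun x => ⟨ciInf_le hbdd x, by
      have : g x - c ≤ ⨅ y, g y := le_ciInf fun y => by linarith [(abs_le.1 (hc x y)).2]
      linarith⟩)
  simpa using h

/-- Sub-Gaussian deviations of the sections and of the partial mean add up. -/
lemma hasSubgaussianMGF_prod (μ : Measure Ω) (ν : Measure Ω') [IsProbabilityMeasure μ]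
    [IsProbabilityMeasure ν] {g : Ω × Ω' → ℝ} (hg : Measurable g) {M : ℝ} (hM : ∀ x, |g x| ≤ M)
    {c₁ c₂ : ℝ≥0}
    (h₂ : ∀ x, HasSubgaussianMGF (fun y => g (x, y) - ∫ y', g (x, y') ∂ν) c₂ ν)
    (h₁ : HasSubgaussianMGF
      (fun x => ∫ y, g (x, y) ∂ν - ∫ x', ∫ y, g (x', y) ∂ν ∂μ) c₁ μ) :
    HasSubgaussianMGF (fun p => g p - ∫ p', g p' ∂(μ.prod ν)) (c₁ + c₂) (μ.prod ν) := by
  have hint : Integrable g (μ.prod ν) := integrable_of_abs_le hg hM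
  set A := ∫ p', g p' ∂(μ.prod ν) with hA
  have hA' : A = ∫ x', ∫ y, g (x', y) ∂ν ∂μ := integral_prod g hint
  have hexp : ∀ t : ℝ, Integrable (fun p => Real.exp (t * (g p - A))) (μ.prod ν) := by
    intro t
    refine integrable_of_abs_le (M := Real.exp (|t| * (M + |A|))) (by fun_prop) fun p => ?_
    rw [abs_of_pos (Real.exp_pos _), Real.exp_le_exp]
    calc t * (g p - A) ≤ |t * (g p - A)| := le_abs_self _
      _ = |t| * |g p - A| := abs_mul _ _
      _ ≤ |t| * (M + |A|) := by
          gcongr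
          exact (abs_sub _ _).trans (by linarith [hM p])
  refine ⟨hexp, fun t => ?_⟩
  rw [mgf, integral_prod _ (hexp t)]
  let G : Ω → ℝ := fun x => ∫ y, g (x, y) ∂ν
  have hsec : ∀ x, ∫ y, Real.exp (t * (g (x, y) - A)) ∂ν
      ≤ Real.exp (t * (G x - A)) * Real.exp (c₂ * t ^ 2 / 2) := by
    intro x
    have : ∀ y, Real.exp (t * (g (x, y) - A))
        = Real.exp (t * (G x - A)) * Real.exp (t * (g (x, y) - G x)) := by
      intro y
      rw [← Real.exp_add]
      ring_nf
    simp_rw [this]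
    rw [integral_const_mul]
    exact mul_le_mul_of_nonneg_left ((h₂ x).mgf_le t) (Real.exp_pos _).le
  have hGi := (h₁.integrable_exp_mul t).mul_const (Real.exp (c₂ * t ^ 2 / 2))
  rw [← hA'] at hGi h₁
  calc _ ≤ ∫ x, Real.exp (t * (G x - A)) * Real.exp (c₂ * t ^ 2 / 2) ∂μ :=
        integral_mono (hexp t).integral_prod_left hGi hsec
    _ = mgf (fun x => G x - A) μ t * Real.exp (c₂ * t ^ 2 / 2) := integral_mul_const _ _
    _ ≤ Real.exp (c₁ * t ^ 2 / 2) * Real.exp (c₂ * t ^ 2 / 2) := by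
        gcongr
        exact h₁.mgf_le t
    _ = _ := by
        rw [← Real.exp_add]
        push_cast
        ring_nf

lemma abs_integral_sub_integral_le {ν : Measure Ω} [IsProbabilityMeasure ν] {f g : Ω → ℝ}
    (hf : Integrable f ν) (hg : Integrable g ν) {c : ℝ} (h : ∀ y, |f y - g y| ≤ c) :
    |∫ y, f y ∂ν - ∫ y, g y ∂ν| ≤ c := by
  rw [← integral_sub hf hg]
  exact abs_integral_le h

/-- **McDiarmid's inequality** in terms of moment generating functions. -/
lemma hasSubgaussianMGF_pi (μ : Measure Ω) [IsProbabilityMeasure μ] (N : ℕ)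
    {g : (Fin N → Ω) → ℝ} (hg : Measurable g) {M : ℝ} (hM : ∀ x, |g x| ≤ M) {c : ℝ≥0}
    (hc : ∀ z i u, |g (Function.update z i u) - g z| ≤ c) :
    HasSubgaussianMGF (fun z => g z - ∫ z', g z' ∂(Measure.pi fun _ => μ)) (N * (c / 2) ^ 2)
      (Measure.pi fun _ => μ) := by
  induction N with
  | zero =>
    have : (fun z => g z - ∫ z', g z' ∂(Measure.pi fun _ => μ)) = fun _ => 0 := by
      funext z
      have : ∀ z', g z' = g z := fun z' => congrArg g (Subsingleton.elim _ _)
      simp [this]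
    rw [this]
    simp
  | succ N ih =>
    -- Split off the first coordinate: the sections fall under the induction hypothesis, and the
    -- partial mean over the other coordinates again oscillates by at most c.
    let e := (MeasurableEquiv.piFinSuccAbove (fun _ : Fin (N + 1) => Ω) 0).symm
    have hmp : MeasurePreserving e (μ.prod (Measure.pi fun _ : Fin N => μ))
        (Measure.pi fun _ : Fin (N + 1) => μ) :=
      (measurePreserving_piFinSuccAbove (fun _ : Fin (N + 1) => μ) 0).symm
    have he : ∀ x y, e (x, y) = Fin.cons x y := fun x y => by
      simp [e, MeasurableEquiv.piFinSuccAbove]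
      rfl
    have hge : Measurable (g ∘ e) := hg.comp e.measurable
    have hMe : ∀ p, |(g ∘ e) p| ≤ M := fun p => hM _
    have hsec : ∀ x, Measurable fun y => (g ∘ e) (x, y) :=
      fun x => hge.comp measurable_prodMk_left
    have h₂ : ∀ x, HasSubgaussianMGF
        (fun y => (g ∘ e) (x, y) - ∫ y', (g ∘ e) (x, y') ∂(Measure.pi fun _ : Fin N => μ))
        (N * (c / 2) ^ 2) (Measure.pi fun _ : Fin N => μ) := by
      intro x
      refine ih (hsec x) (fun y => hMe (x, y)) fun z i u => ?_
      simp only [Function.comp_apply, he]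
      rw [Fin.cons_update]
      exact hc _ _ _
    have h₁ := hasSubgaussianMGF_of_oscillation μ
      (g := fun x => ∫ y, (g ∘ e) (x, y) ∂(Measure.pi fun _ : Fin N => μ))
      hge.stronglyMeasurable.integral_prod_right'.measurable (c := c) fun x x' => by
        refine abs_integral_sub_integral_le (integrable_of_abs_le (hsec x) fun y => hMe (x, y))
          (integrable_of_abs_le (hsec x') fun y => hMe (x', y)) fun y => ?_
        simp only [Function.comp_apply, he]
        have := hc (Fin.cons x' y) 0 x
        rwa [Fin.update_cons_zero] at this
    have h := hasSubgaussianMGF_prod μ _ hge hMe h₂ h₁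
    have h' : HasSubgaussianMGF
        ((fun z => g z - ∫ z', g z' ∂(Measure.pi fun _ : Fin (N + 1) => μ)) ∘ e)
        ((c / 2) ^ 2 + N * (c / 2) ^ 2) (μ.prod (Measure.pi fun _ : Fin N => μ)) := by
      have : ∫ p, (g ∘ e) p ∂(μ.prod (Measure.pi fun _ : Fin N => μ))
          = ∫ z', g z' ∂(Measure.pi fun _ : Fin (N + 1) => μ) :=
        hmp.integral_comp' (g := g)
      rw [this] at h
      exact h
    have hmap : (Measure.pi fun _ : Fin (N + 1) => μ).map e.symm
        = μ.prod (Measure.pi fun _ : Fin N => μ) := hmp.symm.map_eq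
    rw [← hmap] at h'
    have h3 := h'.of_map e.symm.measurable.aemeasurable
    convert h3 using 1
    · funext z
      simp
    · push_cast
      ring

/-- **McDiarmid's inequality** for two independent samples. -/
theorem measure_two_sample_ge_le (μ : Measure Ω) [IsProbabilityMeasure μ] (m n : ℕ)
    {g : (Fin m → Ω) × (Fin n → Ω) → ℝ} (hg : Measurable g) {M : ℝ} (hM : ∀ x, |g x| ≤ M)
    {a b : ℝ≥0} (ha : ∀ x y i u, |g (Function.update x i u, y) - g (x, y)| ≤ a)
    (hb : ∀ x y i u, |g (x, Function.update y i u) - g (x, y)| ≤ b) {η : ℝ} (hη : 0 ≤ η) :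
    ((Measure.pi fun _ : Fin m => μ).prod (Measure.pi fun _ : Fin n => μ)).real
      {p | η ≤ g p - ∫ p', g p' ∂((Measure.pi fun _ => μ).prod (Measure.pi fun _ => μ))}
      ≤ Real.exp (-(2 * η ^ 2) / (m * a ^ 2 + n * b ^ 2)) := by
  have hsec : ∀ x, Measurable fun y => g (x, y) := fun x => hg.comp measurable_prodMk_left
  have hI : ∀ x, Integrable (fun y => g (x, y)) (Measure.pi fun _ : Fin n => μ) :=
    fun x => integrable_of_abs_le (hsec x) fun y => hM (x, y)
  have h := hasSubgaussianMGF_prod (Measure.pi fun _ : Fin m => μ) (Measure.pi fun _ : Fin n => μ)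
    hg hM
    (fun x => hasSubgaussianMGF_pi μ n (hsec x) (fun y => hM (x, y)) fun z i u => hb x z i u)
    (hasSubgaussianMGF_pi μ m (g := fun x => ∫ y, g (x, y) ∂(Measure.pi fun _ => μ)) (M := M)
      hg.stronglyMeasurable.integral_prod_right'.measurable
      (fun x => abs_integral_le fun y => hM (x, y)) fun x i u =>
        abs_integral_sub_integral_le (hI _) (hI _) fun y => ha x y i u)
  refine (h.measure_ge_le hη).trans_eq ?_
  congr 1
  push_cast
  rw [show 2 * ((m : ℝ) * (a / 2) ^ 2 + n * (b / 2) ^ 2) = (m * a ^ 2 + n * b ^ 2) / 2 by ring]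
  rw [div_div_eq_mul_div]
  ring

end McDiarmid

/-! ### Real suprema against extended real ones. -/

section ERealSup

variable {ι : Type*} [Nonempty ι]

lemma coe_real_iSup {u : ι → ℝ} (h : BddAbove (Set.range u)) :
    ((⨆ i, u i : ℝ) : EReal) = ⨆ i, (u i : EReal) := by
  apply le_antisymm
  · have h1 : ∀ i, (u i : EReal) ≤ ⨆ i, (u i : EReal) := le_iSup (fun i => (u i : EReal))
    generalize (⨆ i, (u i : EReal)) = S at h1
    induction S with
    | bot => exact absurd (h1 (Classical.arbitrary ι)) (not_le.2 (EReal.bot_lt_coe _))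
    | top => exact le_top
    | coe r => exact EReal.coe_le_coe_iff.2 (ciSup_le fun i => EReal.coe_le_coe_iff.1 (h1 i))
  · exact iSup_le fun i => EReal.coe_le_coe_iff.2 (le_ciSup h i)

lemma bddAbove_of_iSup_coe_ne_top {u : ι → ℝ} (h : ⨆ i, (u i : EReal) ≠ ⊤) :
    BddAbove (Set.range u) := by
  have h1 : ∀ i, (u i : EReal) ≤ ⨆ i, (u i : EReal) := le_iSup (fun i => (u i : EReal))
  generalize (⨆ i, (u i : EReal)) = S at h h1
  induction S with
  | bot => exact absurd (h1 (Classical.arbitrary ι)) (not_le.2 (EReal.bot_lt_coe _))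
  | top => exact absurd rfl h
  | coe r =>
    refine ⟨r, ?_⟩
    rintro _ ⟨i, rfl⟩
    exact EReal.coe_le_coe_iff.1 (h1 i)

lemma iSup_coe_ne_bot (u : ι → ℝ) : ⨆ i, (u i : EReal) ≠ ⊥ := by
  refine ne_of_gt (lt_of_lt_of_le (EReal.bot_lt_coe (u (Classical.arbitrary ι))) ?_)
  exact le_iSup (fun i => (u i : EReal)) _

/-- No boundedness is needed: in the unbounded case both sides take the default value 0. -/
lemma iSup_eq_toReal (u : ι → ℝ) : ⨆ i, u i = (⨆ i, (u i : EReal)).toReal := by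
  by_cases h : BddAbove (Set.range u)
  · rw [← coe_real_iSup h, EReal.toReal_coe]
  · have : ⨆ i, (u i : EReal) = ⊤ := by
      by_contra hne
      exact h (bddAbove_of_iSup_coe_ne_top hne)
    rw [this, EReal.toReal_top, Real.iSup_of_not_bddAbove h]

end ERealSup

lemma ereal_sum_ne_bot {ι : Type*} {s : Finset ι} {v : ι → EReal} (h : ∀ i ∈ s, v i ≠ ⊥) :
    ∑ i ∈ s, v i ≠ ⊥ := by
  classical
  induction s using Finset.induction_on with
  | empty => simp
  | insert i s hi ih =>
    rw [Finset.sum_insert hi, EReal.add_ne_bot_iff]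
    exact ⟨h i (Finset.mem_insert_self _ _), ih fun j hj => h j (Finset.mem_insert_of_mem hj)⟩

lemma ereal_ne_top_of_sum_ne_top {ι : Type*} {s : Finset ι} {v : ι → EReal}
    (h : ∀ i ∈ s, v i ≠ ⊥) (hs : ∑ i ∈ s, v i ≠ ⊤) : ∀ i ∈ s, v i ≠ ⊤ := by
  classical
  intro i hi htop
  rw [← Finset.add_sum_erase s v hi, htop, EReal.top_add_of_ne_bot
    (ereal_sum_ne_bot fun j hj => h j (Finset.mem_of_mem_erase hj))] at hs
  exact hs rfl

lemma ereal_coe_sum {ι : Type*} (s : Finset ι) (v : ι → ℝ) :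
    ((∑ i ∈ s, v i : ℝ) : EReal) = ∑ i ∈ s, (v i : EReal) := by
  classical
  induction s using Finset.induction_on with
  | empty => simp
  | insert i s hi ih => rw [Finset.sum_insert hi, Finset.sum_insert hi, EReal.coe_add, ih]

/-! ### The two-sample gap and its bounded differences. -/

section TwoSample

variable {Z : Type*}

/-- The supremum over `F` of a linear combination of the values at two samples. -/
noncomputable def linSup (F : Set (Z → ℝ)) {m n : ℕ} (a : Fin m → ℝ) (b : Fin n → ℝ)
    (p : (Fin m → Z) × (Fin n → Z)) : ℝ :=
  ⨆ f : F, (∑ j, a j * f.1 (p.1 j) + ∑ i, b i * f.1 (p.2 i))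

variable {F : Set (Z → ℝ)} {m n t : ℕ}

/-- The two samples are concatenated into one of size m + n, to which the measurability assumption
on suprema applies. -/
lemma measurable_linSup [MeasurableSpace Z] (hFne : F.Nonempty) (hF : IsMeasurableClass F)
    (a : Fin m → ℝ) (b : Fin n → ℝ) : Measurable (linSup F a b) := by
  have : Nonempty F := hFne.to_subtype
  have happ : Measurable fun p : (Fin m → Z) × (Fin n → Z) => Fin.append p.1 p.2 := by
    refine measurable_pi_iff.2 fun k => ?_
    refine Fin.addCases (fun j => ?_) (fun i => ?_) k
    · simp only [Fin.append_left]
      fun_prop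
    · simp only [Fin.append_right]
      fun_prop
  have h := ((hF.measurable_sup (m + n) (Fin.append a b)).comp happ).ereal_toReal
  convert h using 1
  funext p
  simp only [linSup, Function.comp_apply]
  rw [← iSup_eq_toReal]
  simp [Fin.sum_univ_add]

lemma abs_iSup_le {ι : Type*} [Nonempty ι] {u : ι → ℝ} {M : ℝ} (h : ∀ i, |u i| ≤ M) :
    |⨆ i, u i| ≤ M := by
  have hb : BddAbove (Set.range u) := ⟨M, by rintro _ ⟨i, rfl⟩; exact (abs_le.1 (h i)).2⟩
  refine abs_le.2 ⟨?_, ciSup_le fun i => (abs_le.1 (h i)).2⟩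
  exact ((abs_le.1 (h (Classical.arbitrary ι))).1).trans (le_ciSup hb _)

lemma abs_iSup_sub_iSup_le {ι : Type*} [Nonempty ι] {u v : ι → ℝ} {M : ℝ}
    (hu : BddAbove (Set.range u)) (hv : BddAbove (Set.range v)) (h : ∀ i, |u i - v i| ≤ M) :
    |(⨆ i, u i) - ⨆ i, v i| ≤ M := by
  rw [abs_le]
  constructor
  · have : ⨆ i, v i ≤ (⨆ i, u i) + M := ciSup_le fun i => by
      linarith [(abs_le.1 (h i)).1, le_ciSup hu i]
    linarith
  · have : ⨆ i, u i ≤ (⨆ i, v i) + M := ciSup_le fun i => by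
      linarith [(abs_le.1 (h i)).2, le_ciSup hv i]
    linarith

variable {B : ℝ}

/-- Differences of two means of a function of oscillation at most `B`. -/
lemma abs_mean_sub_mean_le {f : Z → ℝ} (hf : ∀ z z', |f z - f z'| ≤ B) (hm : 0 < m) (hn : 0 < n)
    (x : Fin m → Z) (y : Fin n → Z) :
    |∑ j, (1 / m : ℝ) * f (x j) + ∑ i, (-(1 / n) : ℝ) * f (y i)| ≤ B := by
  have hm' : (m : ℝ) ≠ 0 := by positivity
  have hn' : (n : ℝ) ≠ 0 := by positivity
  have : ∑ j, (1 / m : ℝ) * f (x j) + ∑ i, (-(1 / n) : ℝ) * f (y i)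
      = ∑ j, ∑ i, (1 / m : ℝ) * (1 / n) * (f (x j) - f (y i)) := by
    simp only [mul_sub, Finset.sum_sub_distrib, Finset.sum_const, Finset.card_univ,
      Fintype.card_fin, nsmul_eq_mul]
    rw [sub_eq_add_neg]
    congr 1
    · refine Finset.sum_congr rfl fun j _ => ?_
      field_simp
    · rw [← Finset.mul_sum, ← Finset.mul_sum]
      field_simp
  rw [this]
  calc _ ≤ ∑ _j : Fin m, ∑ _i : Fin n, (1 / m : ℝ) * (1 / n) * B := by
        refine (Finset.abs_sum_le_sum_abs _ _).trans (Finset.sum_le_sum fun j _ => ?_)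
        refine (Finset.abs_sum_le_sum_abs _ _).trans (Finset.sum_le_sum fun i _ => ?_)
        rw [abs_mul, abs_of_nonneg (by positivity)]
        exact mul_le_mul_of_nonneg_left (hf _ _) (by positivity)
    _ = B := by
        simp only [Finset.sum_const, Finset.card_univ, Fintype.card_fin, nsmul_eq_mul]
        field_simp

/-- The largest excess of the mean over the first sample over that over the second one. -/
noncomputable def meanGap (F : Set (Z → ℝ)) (p : (Fin m → Z) × (Fin n → Z)) : ℝ :=
  linSup F (fun _ => (1 / m : ℝ)) (fun _ => (-(1 / n) : ℝ)) p

lemma abs_meanGap_le (hFne : F.Nonempty) (hFB : ∀ f ∈ F, ∀ z z', |f z - f z'| ≤ B) (hm : 0 < m)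
    (hn : 0 < n) (p : (Fin m → Z) × (Fin n → Z)) : |meanGap F p| ≤ B := by
  have : Nonempty F := hFne.to_subtype
  exact abs_iSup_le fun f => abs_mean_sub_mean_le (hFB f.1 f.2) hm hn p.1 p.2

lemma bddAbove_meanGap (hFB : ∀ f ∈ F, ∀ z z', |f z - f z'| ≤ B) (hm : 0 < m)
    (hn : 0 < n) (p : (Fin m → Z) × (Fin n → Z)) : BddAbove (Set.range fun f : F =>
      ∑ j, (1 / m : ℝ) * f.1 (p.1 j) + ∑ i, (-(1 / n) : ℝ) * f.1 (p.2 i)) := by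
  refine ⟨B, ?_⟩
  rintro _ ⟨f, rfl⟩
  exact (abs_le.1 (abs_mean_sub_mean_le (hFB f.1 f.2) hm hn p.1 p.2)).2

/-- The contribution of one coordinate to a linear combination of values of a function of
oscillation at most `B`. -/
lemma abs_sum_update_sub_le {f : Z → ℝ} (hf : ∀ z z', |f z - f z'| ≤ B) (a : ℝ)
    (x : Fin t → Z) (k : Fin t) (u : Z) :
    |∑ j, a * f (Function.update x k u j) - ∑ j, a * f (x j)| ≤ |a| * B := by
  rw [← Finset.sum_sub_distrib, Finset.sum_eq_single k]
  · rw [Function.update_self, ← mul_sub, abs_mul]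
    exact mul_le_mul_of_nonneg_left (hf _ _) (abs_nonneg _)
  · intro j _ hj
    rw [Function.update_of_ne hj, sub_self]
  · simp

lemma abs_meanGap_update_left_le (hFne : F.Nonempty)
    (hFB : ∀ f ∈ F, ∀ z z', |f z - f z'| ≤ B) (hm : 0 < m) (hn : 0 < n) (x : Fin m → Z)
    (y : Fin n → Z) (k : Fin m) (u : Z) :
    |meanGap F (Function.update x k u, y) - meanGap F (x, y)| ≤ B / m := by
  have : Nonempty F := hFne.to_subtype
  refine abs_iSup_sub_iSup_le (bddAbove_meanGap hFB hm hn _) (bddAbove_meanGap hFB hm hn _)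
    fun f => ?_
  rw [add_sub_add_right_eq_sub]
  refine (abs_sum_update_sub_le (hFB f.1 f.2) (1 / m : ℝ) x k u).trans_eq ?_
  rw [abs_of_nonneg (by positivity)]
  ring

lemma abs_meanGap_update_right_le (hFne : F.Nonempty)
    (hFB : ∀ f ∈ F, ∀ z z', |f z - f z'| ≤ B) (hm : 0 < m) (hn : 0 < n) (x : Fin m → Z)
    (y : Fin n → Z) (k : Fin n) (u : Z) :
    |meanGap F (x, Function.update y k u) - meanGap F (x, y)| ≤ B / n := by
  have : Nonempty F := hFne.to_subtype
  refine abs_iSup_sub_iSup_le (bddAbove_meanGap hFB hm hn _) (bddAbove_meanGap hFB hm hn _)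
    fun f => ?_
  rw [add_sub_add_left_eq_sub]
  refine (abs_sum_update_sub_le (hFB f.1 f.2) (-(1 / n) : ℝ) y k u).trans_eq ?_
  rw [abs_neg, abs_of_nonneg (by positivity)]
  ring

end TwoSample

/-! ### Symmetrization. -/

section Symmetrization

variable {Z : Type*} {F : Set (Z → ℝ)} {t : ℕ}

lemma iSup_rademacher_ne_bot (hFne : F.Nonempty) (z : Fin t → Z) (σ : Fin t → ℤˣ) :
    ⨆ f : F, (((1 / t : ℝ) * ∑ i, ((σ i : ℤ) : ℝ) * f.1 (z i) : ℝ) : EReal) ≠ ⊥ := by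
  have : Nonempty F := hFne.to_subtype
  exact iSup_coe_ne_bot _

lemma bddAbove_of_empRademacher_ne_top (hFne : F.Nonempty) {z : Fin t → Z}
    (hz : empRademacher F z ≠ ∞) (σ : Fin t → ℤˣ) :
    BddAbove (Set.range fun f : F => (1 / t : ℝ) * ∑ i, ((σ i : ℤ) : ℝ) * f.1 (z i)) := by
  have : Nonempty F := hFne.to_subtype
  apply bddAbove_of_iSup_coe_ne_top
  refine ereal_ne_top_of_sum_ne_top (s := Finset.univ)
    (fun σ _ => iSup_rademacher_ne_bot hFne z σ) ?_ σ (Finset.mem_univ _)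
  intro htop
  apply hz
  rw [empRademacher, htop, EReal.toENNReal_top]
  exact ENNReal.top_div_of_ne_top (by simp)

lemma sum_iSup_le_toReal_empRademacher (hFne : F.Nonempty) {z : Fin t → Z}
    (hz : empRademacher F z ≠ ∞) :
    ∑ σ : Fin t → ℤˣ, ⨆ f : F, (1 / t : ℝ) * ∑ i, ((σ i : ℤ) : ℝ) * f.1 (z i)
      ≤ 2 ^ t * (empRademacher F z).toReal := by
  have : Nonempty F := hFne.to_subtype
  have hb := bddAbove_of_empRademacher_ne_top hFne hz
  have h1 : empRademacher F z = ENNReal.ofReal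
      (∑ σ : Fin t → ℤˣ, ⨆ f : F, (1 / t : ℝ) * ∑ i, ((σ i : ℤ) : ℝ) * f.1 (z i)) / 2 ^ t := by
    rw [empRademacher]
    simp_rw [← coe_real_iSup (hb _)]
    rw [← ereal_coe_sum, EReal.toENNReal_of_ne_top (EReal.coe_ne_top _), EReal.toReal_coe]
  rw [h1, ENNReal.toReal_div, ENNReal.toReal_pow]
  simp only [ENNReal.toReal_ofNat]
  rw [mul_div_cancel₀ _ (by positivity)]
  exact ENNReal.toReal_ofReal' ▸ le_max_left _ _

/-- The pair of samples with the coordinates of negative sign interchanged. -/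
def swapBy (σ : Fin t → ℤˣ) (p : (Fin t → Z) × (Fin t → Z)) : (Fin t → Z) × (Fin t → Z) :=
  (fun i => if σ i = 1 then p.1 i else p.2 i, fun i => if σ i = 1 then p.2 i else p.1 i)

/-- Interchanging the i-th points of the two samples flips the sign of the i-th difference. -/
lemma linear_swapBy (f : Z → ℝ) (σ : Fin t → ℤˣ) (p : (Fin t → Z) × (Fin t → Z)) :
    ∑ j, (1 / t : ℝ) * f ((swapBy σ p).1 j) + ∑ i, (-(1 / t) : ℝ) * f ((swapBy σ p).2 i)
      = (1 / t : ℝ) * ∑ i, ((σ i : ℤ) : ℝ) * f (p.1 i)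
        + (1 / t : ℝ) * ∑ i, (((-σ) i : ℤˣ) : ℤ) * f (p.2 i) := by
  rw [Finset.mul_sum, Finset.mul_sum, ← Finset.sum_add_distrib, ← Finset.sum_add_distrib]
  refine Finset.sum_congr rfl fun i _ => ?_
  simp only [swapBy, Pi.neg_apply]
  rcases Int.units_eq_one_or (σ i) with h | h
  · rw [h]
    simp
  · rw [h]
    have : (-1 : ℤˣ) ≠ 1 := by decide
    simp only [this, if_false]
    simp
    ring

/-- Symmetrization, for a fixed pair of samples. -/
lemma sum_meanGap_swapBy_le (hFne : F.Nonempty) {p : (Fin t → Z) × (Fin t → Z)}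
    (h₁ : empRademacher F p.1 ≠ ∞) (h₂ : empRademacher F p.2 ≠ ∞) :
    ∑ σ : Fin t → ℤˣ, meanGap F (swapBy σ p)
      ≤ 2 ^ t * ((empRademacher F p.1).toReal + (empRademacher F p.2).toReal) := by
  have : Nonempty F := hFne.to_subtype
  let u : (Fin t → Z) → (Fin t → ℤˣ) → ℝ := fun z σ =>
    ⨆ f : F, (1 / t : ℝ) * ∑ i, ((σ i : ℤ) : ℝ) * f.1 (z i)
  have hle : ∀ σ, meanGap F (swapBy σ p) ≤ u p.1 σ + u p.2 (-σ) := by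
    intro σ
    refine ciSup_le fun f => ?_
    rw [linear_swapBy]
    exact add_le_add (le_ciSup (bddAbove_of_empRademacher_ne_top hFne h₁ σ) f)
      (le_ciSup (bddAbove_of_empRademacher_ne_top hFne h₂ (-σ)) f)
  calc _ ≤ ∑ σ, (u p.1 σ + u p.2 (-σ)) := Finset.sum_le_sum fun σ _ => hle σ
    _ = ∑ σ, u p.1 σ + ∑ σ, u p.2 σ := by
        -- The second sample carries the signs -σ, which are again uniform.
        have hneg : ∑ σ, u p.2 (-σ) = ∑ σ, u p.2 σ := Equiv.sum_comp (Equiv.neg _) (u p.2)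
        rw [Finset.sum_add_distrib, hneg]
    _ ≤ _ := by
        rw [mul_add]
        exact add_le_add (sum_iSup_le_toReal_empRademacher hFne h₁)
          (sum_iSup_le_toReal_empRademacher hFne h₂)

variable [MeasurableSpace Z]

lemma measurable_empRademacher (hF : IsMeasurableClass F) :
    Measurable fun z : Fin t → Z => empRademacher F z := by
  unfold empRademacher
  refine Measurable.div_const (Measurable.ereal_toENNReal ?_) _
  refine Finset.measurable_fun_sum _ fun σ _ => ?_
  convert hF.measurable_sup t fun i => (1 / t : ℝ) * ((σ i : ℤ) : ℝ) using 6
  simp only [Finset.mul_sum, mul_assoc]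

lemma measurePreserving_swapBy (P : Measure Z) [IsProbabilityMeasure P] (σ : Fin t → ℤˣ) :
    MeasurePreserving (swapBy σ)
      ((Measure.pi fun _ : Fin t => P).prod (Measure.pi fun _ : Fin t => P))
      ((Measure.pi fun _ : Fin t => P).prod (Measure.pi fun _ : Fin t => P)) := by
  have e := measurePreserving_arrowProdEquivProdArrow Z Z (Fin t) (fun _ => P) (fun _ => P)
  let s : Fin t → Z × Z → Z × Z := fun i => if σ i = 1 then id else Prod.swap
  have hs : ∀ i, MeasurePreserving (s i) (P.prod P) (P.prod P) := by
    intro i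
    by_cases h : σ i = 1
    · simp only [s, h, if_true]
      exact MeasurePreserving.id _
    · simp only [s, h, if_false]
      exact Measure.measurePreserving_swap
  have hpi := measurePreserving_pi (fun _ : Fin t => P.prod P) (fun _ : Fin t => P.prod P) hs
  have h := (e.comp hpi).comp e.symm
  have : swapBy σ = (MeasurableEquiv.arrowProdEquivProdArrow Z Z (Fin t) ∘
      fun a i => s i (a i)) ∘ (MeasurableEquiv.arrowProdEquivProdArrow Z Z (Fin t)).symm := by
    funext p
    ext i
    · simp only [swapBy, Function.comp, MeasurableEquiv.arrowProdEquivProdArrow,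
        MeasurableEquiv.symm_mk, MeasurableEquiv.coe_mk, Equiv.arrowProdEquivProdArrow,
        Equiv.coe_fn_symm_mk, Equiv.coe_fn_mk, s]
      split_ifs <;> rfl
    · simp only [swapBy, Function.comp, MeasurableEquiv.arrowProdEquivProdArrow,
        MeasurableEquiv.symm_mk, MeasurableEquiv.coe_mk, Equiv.arrowProdEquivProdArrow,
        Equiv.coe_fn_symm_mk, Equiv.coe_fn_mk, s]
      split_ifs <;> rfl
  rw [this]
  exact h

variable (P : Measure Z) [IsProbabilityMeasure P] {B : ℝ}

lemma integrable_meanGap {m n : ℕ} (hFne : F.Nonempty) (hF : IsMeasurableClass F)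
    (hFB : ∀ f ∈ F, ∀ z z', |f z - f z'| ≤ B) (hm : 0 < m) (hn : 0 < n) :
    Integrable (meanGap F)
      ((Measure.pi fun _ : Fin m => P).prod (Measure.pi fun _ : Fin n => P)) :=
  integrable_of_abs_le (measurable_linSup hFne hF _ _) (abs_meanGap_le hFne hFB hm hn)

/-- **Symmetrization**: the expected gap between two samples of the same size. -/
lemma integral_meanGap_same_le (hFne : F.Nonempty) (hF : IsMeasurableClass F)
    (hFB : ∀ f ∈ F, ∀ z z', |f z - f z'| ≤ B) (ht : 0 < t) (hR : rademacher P F t ≠ ∞) :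
    ∫ p, meanGap F p ∂((Measure.pi fun _ : Fin t => P).prod (Measure.pi fun _ : Fin t => P))
      ≤ 2 * (rademacher P F t).toReal := by
  set Q := Measure.pi fun _ : Fin t => P with hQ
  have hm := measurable_empRademacher (t := t) hF
  have hfin : ∀ᵐ z ∂Q, empRademacher F z < ∞ := ae_lt_top hm hR
  have hint : Integrable (fun z => (empRademacher F z).toReal) Q :=
    integrable_toReal_of_lintegral_ne_top hm.aemeasurable hR
  have hval : ∫ z, (empRademacher F z).toReal ∂Q = (rademacher P F t).toReal :=
    integral_toReal hm.aemeasurable hfin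
  have hgi := integrable_meanGap (m := t) (n := t) P hFne hF hFB ht ht
  have hswap : ∀ σ : Fin t → ℤˣ,
      ∫ p, meanGap F (swapBy σ p) ∂(Q.prod Q) = ∫ p, meanGap F p ∂(Q.prod Q) := by
    intro σ
    have hp := measurePreserving_swapBy P σ
    have := integral_map (μ := Q.prod Q) (φ := swapBy σ) (f := meanGap F)
      hp.measurable.aemeasurable (by rw [hp.map_eq]; exact hgi.aestronglyMeasurable)
    rw [hp.map_eq] at this
    exact this.symm
  have hsi : ∀ σ : Fin t → ℤˣ, Integrable (fun p => meanGap F (swapBy σ p)) (Q.prod Q) :=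
    fun σ => (measurePreserving_swapBy P σ).integrable_comp_of_integrable hgi
  have hcard : ((Finset.univ : Finset (Fin t → ℤˣ)).card : ℝ) = 2 ^ t := by
    simp [Finset.card_univ]
  have h1 : 2 ^ t * ∫ p, meanGap F p ∂(Q.prod Q)
      = ∫ p, ∑ σ : Fin t → ℤˣ, meanGap F (swapBy σ p) ∂(Q.prod Q) := by
    rw [integral_finsetSum _ fun σ _ => hsi σ]
    simp_rw [hswap]
    rw [Finset.sum_const, nsmul_eq_mul, hcard]
  have h2 : ∫ p, ∑ σ : Fin t → ℤˣ, meanGap F (swapBy σ p) ∂(Q.prod Q)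
      ≤ ∫ p, 2 ^ t * ((empRademacher F p.1).toReal + (empRademacher F p.2).toReal) ∂(Q.prod Q) := by
    refine integral_mono_ae ?_ ?_ ?_
    · exact integrable_finsetSum _ fun σ _ => hsi σ
    · exact ((hint.comp_fst Q).add (hint.comp_snd Q)).const_mul _
    · have a1 := Measure.quasiMeasurePreserving_fst (μ := Q) (ν := Q) |>.ae hfin
      have a2 := Measure.quasiMeasurePreserving_snd (μ := Q) (ν := Q) |>.ae hfin
      filter_upwards [a1, a2] with p h₁ h₂
      exact sum_meanGap_swapBy_le hFne h₁.ne h₂.ne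
  rw [integral_const_mul, integral_add (hint.comp_fst Q) (hint.comp_snd Q)] at h2
  have i1 : ∫ p, (empRademacher F p.1).toReal ∂(Q.prod Q) = (rademacher P F t).toReal := by
    rw [integral_fun_fst (fun z => (empRademacher F z).toReal), hval]
    simp
  have i2 : ∫ p, (empRademacher F p.2).toReal ∂(Q.prod Q) = (rademacher P F t).toReal := by
    rw [integral_fun_snd (fun z => (empRademacher F z).toReal), hval]
    simp
  rw [← h1, i1, i2] at h2
  have := le_of_mul_le_mul_left h2 (by positivity : (0 : ℝ) < 2 ^ t)
  linarith

end Symmetrization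

/-! ### Uniform deviation between samples of different sizes. -/

section Deviation

variable {Z : Type*} {F : Set (Z → ℝ)} {m n t : ℕ} [MeasurableSpace Z] (P : Measure Z)
  [IsProbabilityMeasure P] {B : ℝ}

lemma integrable_of_oscillation {f : Z → ℝ} (hf : Measurable f) (hB : ∀ z z', |f z - f z'| ≤ B) :
    Integrable f P := by
  obtain ⟨z₀⟩ : Nonempty Z := P.nonempty_of_neZero
  refine integrable_of_abs_le hf (M := |f z₀| + B) fun z => ?_
  calc |f z| = |f z₀ + (f z - f z₀)| := by ring_nf
    _ ≤ _ := (abs_add_le _ _).trans (by linarith [hB z z₀])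

lemma integral_mean {f : Z → ℝ} (hf : Integrable f P) (ht : 0 < t) (a : ℝ) :
    ∫ x : Fin t → Z, ∑ i, (a / t) * f (x i) ∂(Measure.pi fun _ => P) = a * ∫ z, f z ∂P := by
  have hi : ∀ i : Fin t, Integrable (fun x : Fin t → Z => f (x i)) (Measure.pi fun _ => P) :=
    fun i => (measurePreserving_eval (fun _ : Fin t => P) i).integrable_comp_of_integrable hf
  rw [integral_finsetSum _ fun i _ => (hi i).const_mul _]
  simp_rw [integral_const_mul]
  have : ∀ i : Fin t, ∫ x : Fin t → Z, f (x i) ∂(Measure.pi fun _ => P) = ∫ z, f z ∂P :=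
    fun i => integral_comp_eval (μ := fun _ : Fin t => P) hf.aestronglyMeasurable
  simp_rw [this]
  rw [Finset.sum_const, Finset.card_univ, Fintype.card_fin, nsmul_eq_mul]
  field_simp

lemma integrable_mean {f : Z → ℝ} (hf : Integrable f P) (a : ℝ) :
    Integrable (fun x : Fin t → Z => ∑ i, a * f (x i)) (Measure.pi fun _ => P) :=
  integrable_finsetSum _ fun i _ =>
    ((measurePreserving_eval (fun _ : Fin t => P) i).integrable_comp_of_integrable hf).const_mul a

/-- Comparison of the gap with ghost samples of equal size. -/
lemma meanGap_le_integral_add (hFne : F.Nonempty) (hF : IsMeasurableClass F)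
    (hFB : ∀ f ∈ F, ∀ z z', |f z - f z'| ≤ B) (hm : 0 < m) (hn : 0 < n)
    (x : Fin m → Z) (y : Fin n → Z) :
    meanGap F (x, y) ≤ ∫ x' : Fin m → Z, meanGap F (x, x') ∂(Measure.pi fun _ => P)
      + ∫ y' : Fin n → Z, meanGap F (y', y) ∂(Measure.pi fun _ => P) := by
  have : Nonempty F := hFne.to_subtype
  refine ciSup_le fun f => ?_
  have hfi := integrable_of_oscillation P (hF.measurable f.1 f.2) (hFB f.1 f.2)
  have h₁ : ∑ j, (1 / m : ℝ) * f.1 (x j) - ∫ z, f.1 z ∂P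
      ≤ ∫ x' : Fin m → Z, meanGap F (x, x') ∂(Measure.pi fun _ => P) := by
    have e : ∑ j, (1 / m : ℝ) * f.1 (x j) - ∫ z, f.1 z ∂P = ∫ x' : Fin m → Z,
        (∑ j, (1 / m : ℝ) * f.1 (x j) + ∑ i, (-(1 / m) : ℝ) * f.1 (x' i))
          ∂(Measure.pi fun _ => P) := by
      rw [integral_add (integrable_const _) (integrable_mean P hfi _), ← neg_div,
        integral_mean P hfi hm]
      simp [sub_eq_add_neg]
    rw [e]
    refine integral_mono ((integrable_const _).add (integrable_mean P hfi _)) ?_ fun x' =>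
      le_ciSup (bddAbove_meanGap hFB hm hm (x, x')) f
    exact integrable_of_abs_le ((measurable_linSup hFne hF _ _).comp measurable_prodMk_left)
      fun x' => abs_meanGap_le hFne hFB hm hm (x, x')
  have h₂ : ∫ z, f.1 z ∂P + ∑ i, (-(1 / n) : ℝ) * f.1 (y i)
      ≤ ∫ y' : Fin n → Z, meanGap F (y', y) ∂(Measure.pi fun _ => P) := by
    have e : ∫ z, f.1 z ∂P + ∑ i, (-(1 / n) : ℝ) * f.1 (y i) = ∫ y' : Fin n → Z,
        (∑ j, (1 / n : ℝ) * f.1 (y' j) + ∑ i, (-(1 / n) : ℝ) * f.1 (y i))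
          ∂(Measure.pi fun _ => P) := by
      rw [integral_add (integrable_mean P hfi _) (integrable_const _), integral_mean P hfi hn]
      simp
    rw [e]
    refine integral_mono ((integrable_mean P hfi _).add (integrable_const _)) ?_ fun y' =>
      le_ciSup (bddAbove_meanGap hFB hn hn (y', y)) f
    exact integrable_of_abs_le ((measurable_linSup hFne hF _ _).comp measurable_prodMk_right)
      fun y' => abs_meanGap_le hFne hFB hn hn (y', y)
  linarith

/-- Symmetrization needs equal sizes. Passing through the population mean yields one m-against-m gap
and one n-against-n gap. -/
lemma integral_meanGap_le (hFne : F.Nonempty) (hF : IsMeasurableClass F)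
    (hFB : ∀ f ∈ F, ∀ z z', |f z - f z'| ≤ B) (hm : 0 < m) (hn : 0 < n)
    (hRm : rademacher P F m ≠ ∞) (hRn : rademacher P F n ≠ ∞) :
    ∫ p, meanGap F p ∂((Measure.pi fun _ : Fin m => P).prod (Measure.pi fun _ : Fin n => P))
      ≤ 2 * ((rademacher P F m).toReal + (rademacher P F n).toReal) := by
  have hmm := integrable_meanGap (m := m) (n := m) P hFne hF hFB hm hm
  have hnn := integrable_meanGap (m := n) (n := n) P hFne hF hFB hn hn
  have i₁ := hmm.integral_prod_left.comp_fst (Measure.pi fun _ : Fin n => P)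
  have i₂ := hnn.integral_prod_right.comp_snd (Measure.pi fun _ : Fin m => P)
  calc _ ≤ ∫ p : (Fin m → Z) × (Fin n → Z),
        ((∫ x' : Fin m → Z, meanGap F (p.1, x') ∂(Measure.pi fun _ => P))
          + ∫ y' : Fin n → Z, meanGap F (y', p.2) ∂(Measure.pi fun _ => P))
          ∂((Measure.pi fun _ : Fin m => P).prod (Measure.pi fun _ : Fin n => P)) :=
        integral_mono (integrable_meanGap P hFne hF hFB hm hn) (i₁.add i₂) fun p =>
          meanGap_le_integral_add P hFne hF hFB hm hn p.1 p.2
    _ = (∫ p, meanGap F p ∂((Measure.pi fun _ : Fin m => P).prod (Measure.pi fun _ : Fin m => P)))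
        + ∫ p, meanGap F p
          ∂((Measure.pi fun _ : Fin n => P).prod (Measure.pi fun _ : Fin n => P)) := by
        rw [integral_add i₁ i₂, integral_prod _ hmm, integral_prod_symm _ hnn]
        congr 1
        · rw [integral_fun_fst (fun x : Fin m → Z => ∫ x' : Fin m → Z, meanGap F (x, x')
            ∂(Measure.pi fun _ => P))]
          simp
        · rw [integral_fun_snd (fun y : Fin n → Z => ∫ y' : Fin n → Z, meanGap F (y', y)
            ∂(Measure.pi fun _ => P))]
          simp
    _ ≤ _ := by
        linarith [integral_meanGap_same_le P hFne hF hFB hm hRm,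
          integral_meanGap_same_le P hFne hF hFB hn hRn]

/-- The uniform deviation of two independent samples. -/
theorem measure_meanGap_gt_le (hFne : F.Nonempty) (hF : IsMeasurableClass F)
    (hFB : ∀ f ∈ F, ∀ z z', |f z - f z'| ≤ B) (hm : 0 < m) (hn : 0 < n)
    (hRm : rademacher P F m ≠ ∞) (hRn : rademacher P F n ≠ ∞) {δ : ℝ} (hδ0 : 0 < δ)
    (hδ1 : δ < 1) :
    ((Measure.pi fun _ : Fin m => P).prod (Measure.pi fun _ : Fin n => P))
      {p | 2 * ((rademacher P F m).toReal + (rademacher P F n).toReal)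
        + B * √((1 / n + 1 / m) * (Real.log (2 / δ) / 2)) < meanGap F p}
      ≤ ENNReal.ofReal (δ / 2) := by
  obtain ⟨z₀⟩ : Nonempty Z := P.nonempty_of_neZero
  obtain ⟨f₀, hf₀⟩ := hFne
  have hFne : F.Nonempty := ⟨f₀, hf₀⟩
  have hB0 : 0 ≤ B := (abs_nonneg _).trans (hFB f₀ hf₀ z₀ z₀)
  have hlog : 0 < Real.log (2 / δ) := Real.log_pos (by rw [lt_div_iff₀ hδ0]; linarith)
  have hm' : (0 : ℝ) < m := by exact_mod_cast hm
  have hn' : (0 : ℝ) < n := by exact_mod_cast hn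
  -- For B = 0 the exponent in McDiarmid's inequality degenerates to 0/0, but then the gap is never
  -- positive.
  rcases hB0.eq_or_lt with rfl | hB
  · rw [Set.eq_empty_of_forall_notMem (s := {p | _ < meanGap F p})]
    · simp
    · intro p hp
      have h1 := (abs_le.1 (abs_meanGap_le hFne hFB hm hn p)).2
      have h2 : (0 : ℝ) ≤ 2 * ((rademacher P F m).toReal + (rademacher P F n).toReal) := by
        positivity
      rw [Set.mem_ofPred_eq, zero_mul] at hp
      linarith
  set η := B * √((1 / n + 1 / m) * (Real.log (2 / δ) / 2)) with hη
  have hη0 : 0 ≤ η := by positivity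
  have h := measure_two_sample_ge_le P m n (g := meanGap F) (measurable_linSup hFne hF _ _)
    (abs_meanGap_le hFne hFB hm hn) (a := ⟨B / m, by positivity⟩) (b := ⟨B / n, by positivity⟩)
    (abs_meanGap_update_left_le hFne hFB hm hn) (abs_meanGap_update_right_le hFne hFB hm hn) hη0
  have hexp : Real.exp (-(2 * η ^ 2) / (m * (B / m) ^ 2 + n * (B / n) ^ 2)) = δ / 2 := by
    have : -(2 * η ^ 2) / (m * (B / m) ^ 2 + n * (B / n) ^ 2) = -Real.log (2 / δ) := by
      rw [hη, mul_pow, Real.sq_sqrt (by positivity)]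
      field_simp
      ring
    rw [this, ← Real.log_inv, Real.exp_log (by positivity), inv_div]
  have h' : _ ≤ δ / 2 := h.trans_eq hexp
  rw [← ENNReal.ofReal_le_ofReal_iff (by positivity), ofReal_measureReal] at h'
  refine le_trans (measure_mono fun p hp => ?_) h'
  have := integral_meanGap_le P hFne hF hFB hm hn hRm hRn
  simp only [Set.mem_ofPred_eq] at hp ⊢
  linarith

end Deviation

/-! ### Weighted quantiles of finitely many values. -/

section Quantile

variable {ι : Type*} [Fintype ι] {s p : ι → ℝ} {β : ℝ}

/-- The quantile level is reached at the quantile. -/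
lemma le_sum_quantile (hp : ∀ i, 0 ≤ p i) (hq : quantile s p β ≠ ⊤) :
    β ≤ ∑ i, p i * (if (s i : EReal) ≤ quantile s p β then 1 else 0) := by
  set q₀ := quantile s p β with hq₀
  -- Only finitely many values lie above the quantile, so some admissible q lies below all of them
  -- and sees no more mass than the quantile does. The empty infimum `⊤` is covered by `hq`.
  have hlt : q₀ < (Finset.univ.filter fun i => q₀ < s i).inf fun i => (s i : EReal) := by
    rw [Finset.lt_inf_iff (lt_top_iff_ne_top.2 hq)]
    exact fun i hi => (Finset.mem_filter.1 hi).2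
  have hlt' := hlt
  conv_lhs at hlt' => rw [hq₀, quantile]
  obtain ⟨_, ⟨q, hq1, rfl⟩, hq2⟩ := sInf_lt_iff.1 hlt'
  refine le_trans hq1 (Finset.sum_le_sum fun i _ => mul_le_mul_of_nonneg_left ?_ (hp i))
  by_cases h : (s i : EReal) ≤ q₀
  · rw [if_pos h]
    split_ifs <;> norm_num
  · have h1 : ((Finset.univ.filter fun i => q₀ < s i).inf fun i => (s i : EReal)) ≤ s i :=
      Finset.inf_le (Finset.mem_filter.2 ⟨Finset.mem_univ i, not_le.1 h⟩)
    have h2 : q < s i := EReal.coe_lt_coe_iff.1 (hq2.trans_le h1)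
    rw [if_neg (not_le.2 h2), if_neg h]

/-- For distinct values the quantile level is exceeded by one atom at most. -/
lemma sum_quantile_le {κ : ℝ} (hβ : 0 ≤ β) (hκ : 0 ≤ κ) (hp : ∀ i, 0 ≤ p i) (hpκ : ∀ i, p i ≤ κ)
    (hs : Function.Injective s) :
    ∑ i, p i * (if (s i : EReal) ≤ quantile s p β then 1 else 0) ≤ β + κ := by
  set q₀ := quantile s p β with hq₀
  rcases eq_or_ne q₀ ⊥ with hbot | hbot
  · rw [hbot]
    have : ∑ i, p i * (if (s i : EReal) ≤ ⊥ then (1 : ℝ) else 0) = 0 := by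
      refine Finset.sum_eq_zero fun i _ => ?_
      rw [if_neg (not_le.2 (EReal.bot_lt_coe _)), mul_zero]
    linarith
  have hlt : ((Finset.univ.filter fun i => (s i : EReal) < q₀).sup fun i => (s i : EReal)) < q₀ := by
    rw [Finset.sup_lt_iff (bot_lt_iff_ne_bot.2 hbot)]
    exact fun i hi => (Finset.mem_filter.1 hi).2
  -- This q lies below the quantile, hence is not admissible, yet above every smaller value. Only
  -- the atom at the quantile itself is missed.
  obtain ⟨q, hq1, hq2⟩ := EReal.lt_iff_exists_real_btwn.1 hlt
  have hnot : ¬ β ≤ ∑ i, p i * (if s i ≤ q then 1 else 0) := fun h =>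
    absurd (sInf_le ⟨q, h, rfl⟩ : q₀ ≤ (q : EReal)) (not_le.2 hq2)
  have hatom : ∑ i, p i * (if (s i : EReal) = q₀ then 1 else 0) ≤ κ := by
    by_cases h : ∃ i, (s i : EReal) = q₀
    · obtain ⟨i, hi⟩ := h
      rw [Finset.sum_eq_single i]
      · rw [if_pos hi, mul_one]
        exact hpκ i
      · intro j _ hj
        rw [if_neg, mul_zero]
        intro hj'
        exact hj (hs (EReal.coe_eq_coe_iff.1 (hj'.trans hi.symm)))
      · simp
    · rw [Finset.sum_eq_zero]
      · exact hκ
      · intro i _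
        rw [if_neg fun hi => h ⟨i, hi⟩, mul_zero]
  have hle : ∑ i, p i * (if (s i : EReal) ≤ q₀ then (1 : ℝ) else 0)
      ≤ ∑ i, p i * (if s i ≤ q then 1 else 0)
        + ∑ i, p i * (if (s i : EReal) = q₀ then 1 else 0) := by
    rw [← Finset.sum_add_distrib]
    refine Finset.sum_le_sum fun i _ => ?_
    rw [← mul_add]
    refine mul_le_mul_of_nonneg_left ?_ (hp i)
    rcases lt_trichotomy (s i : EReal) q₀ with h | h | h
    · have h1 : (s i : EReal)
          ≤ (Finset.univ.filter fun i => (s i : EReal) < q₀).sup fun i => (s i : EReal) :=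
        Finset.le_sup (f := fun i => (s i : EReal)) (Finset.mem_filter.2 ⟨Finset.mem_univ i, h⟩)
      have h2 : s i ≤ q := (EReal.coe_lt_coe_iff.1 (h1.trans_lt hq1)).le
      rw [if_pos h.le, if_pos h2, if_neg h.ne]
      norm_num
    · rw [if_pos h.le, if_pos h]
      split_ifs <;> norm_num
    · rw [if_neg (not_le.2 h), if_neg h.ne']
      split_ifs <;> norm_num
  linarith [not_le.1 hnot]

end Quantile

/-! ### From rational thresholds to arbitrary extended real ones. -/

section EmpiricalCoverage

variable {Z : Type*} [MeasurableSpace Z] (P : Measure Z) [IsProbabilityMeasure P] {n : ℕ} {e : ℝ}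
  {s : Z → ℝ} {z : Fin n → Z}

lemma count_le_of_rat (hs : Measurable s) (he : 0 ≤ e)
    (h : ∀ r : ℚ, countLE (fun i => s (z i)) r ≤ n * (P.real {x | s x ≤ r} + e)) (q : EReal) :
    ∑ i, (if (s (z i) : EReal) ≤ q then (1 : ℝ) else 0)
      ≤ n * (P.real {x | (s x : EReal) ≤ q} + e) := by
  induction q with
  | bot =>
    simp only [le_bot_iff, EReal.coe_ne_bot, if_false, Finset.sum_const_zero]
    positivity
  | top =>
    simp only [le_top, if_true, Set.ofPred_true, probReal_univ]
    simp
    nlinarith [Nat.cast_nonneg (α := ℝ) n]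
  | coe q =>
    simp only [EReal.coe_le_coe_iff]
    have : IsProbabilityMeasure (P.map s) := Measure.isProbabilityMeasure_map hs.aemeasurable
    have hF : ∀ r : ℝ, P.real {x | s x ≤ r} = cdf (P.map s) r := fun r => by
      rw [cdf_eq_real, map_measureReal_apply hs measurableSet_Iic]
      rfl
    by_contra hcon
    rw [not_le, hF] at hcon
    -- By right continuity, an excess at q persists at a rational slightly to its right.
    have hc : ContinuousWithinAt (fun r => n * (cdf (P.map s) r + e)) (Set.Ici q) q :=
      (((cdf (P.map s)).right_continuous q).add continuousWithinAt_const).const_mul _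
    have hev := hc.eventually (gt_mem_nhds hcon)
    obtain ⟨u, hu, hsub⟩ := mem_nhdsGE_iff_exists_Ico_subset.1 hev
    obtain ⟨r, hr1, hr2⟩ := exists_rat_btwn (Set.mem_Ioi.1 hu)
    have h1 : n * (cdf (P.map s) r + e) < _ := hsub ⟨hr1.le, hr2⟩
    have h2 := h r
    rw [hF] at h2
    have h3 : ∑ i, (if s (z i) ≤ q then (1 : ℝ) else 0) ≤ countLE (fun i => s (z i)) r := by
      refine Finset.sum_le_sum fun i _ => ?_
      by_cases hi : s (z i) ≤ q
      · rw [if_pos hi, if_pos (hi.trans hr1.le)]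
      · rw [if_neg hi]
        split_ifs <;> norm_num
    linarith

lemma le_count_of_rat (hs : Measurable s) (he : 0 ≤ e)
    (h : ∀ r : ℚ, countLE (fun i => -s (z i)) r ≤ n * (P.real {x | -s x ≤ r} + e)) (q : EReal) :
    n * (P.real {x | (s x : EReal) ≤ q} - e)
      ≤ ∑ i, (if (s (z i) : EReal) ≤ q then (1 : ℝ) else 0) := by
  have hn0 : (0 : ℝ) ≤ n := Nat.cast_nonneg n
  induction q with
  | bot =>
    simp only [le_bot_iff, EReal.coe_ne_bot, if_false, Finset.sum_const_zero]
    simp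
    positivity
  | top =>
    simp only [le_top, if_true, Set.ofPred_true, probReal_univ]
    simp
    nlinarith
  | coe q =>
    simp only [EReal.coe_le_coe_iff]
    -- The strict event s > q is replaced by -s ≤ r: this loses no sample point and can only
    -- decrease the true probability.
    obtain ⟨r, hr1, hr2⟩ : ∃ r : ℚ, (r : ℝ) < -q ∧ ∀ i, q < s (z i) → -s (z i) ≤ r := by
      have hlt : ((Finset.univ.filter fun i => q < s (z i)).sup fun i => ((-s (z i) : ℝ) : EReal))
          < ((-q : ℝ) : EReal) := by
        rw [Finset.sup_lt_iff (EReal.bot_lt_coe _)]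
        intro i hi
        exact EReal.coe_lt_coe_iff.2 (neg_lt_neg (Finset.mem_filter.1 hi).2)
      obtain ⟨u, hu1, hu2⟩ := EReal.lt_iff_exists_real_btwn.1 hlt
      obtain ⟨r, hr1, hr2⟩ := exists_rat_btwn (EReal.coe_lt_coe_iff.1 hu2)
      refine ⟨r, hr2, fun i hi => ?_⟩
      have h1 : ((-s (z i) : ℝ) : EReal)
          ≤ (Finset.univ.filter fun i => q < s (z i)).sup fun i => ((-s (z i) : ℝ) : EReal) :=
        Finset.le_sup (f := fun i => ((-s (z i) : ℝ) : EReal))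
          (Finset.mem_filter.2 ⟨Finset.mem_univ i, hi⟩)
      exact (EReal.coe_lt_coe_iff.1 (h1.trans_lt hu1)).le.trans hr1.le
    have h1 : P.real {x | -s x ≤ r} ≤ 1 - P.real {x | s x ≤ q} := by
      rw [← probReal_compl_eq_one_sub (measurableSet_le hs measurable_const)]
      refine measureReal_mono fun x hx => ?_
      simp only [Set.mem_compl_iff, Set.mem_ofPred_eq, not_le] at hx ⊢
      linarith
    have h2 : (n : ℝ) - ∑ i, (if s (z i) ≤ q then (1 : ℝ) else 0)
        ≤ countLE (fun i => -s (z i)) r := by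
      have : (n : ℝ) = ∑ _i : Fin n, (1 : ℝ) := by simp
      rw [this, ← Finset.sum_sub_distrib]
      refine Finset.sum_le_sum fun i _ => ?_
      by_cases hi : s (z i) ≤ q
      · rw [if_pos hi]
        split_ifs <;> norm_num
      · rw [if_neg hi, if_pos (hr2 i (not_le.1 hi))]
        norm_num
    have h3 := h r
    have h4 := mul_le_mul_of_nonneg_left h1 hn0
    nlinarith

end EmpiricalCoverage

/-! ### Scores that depend on the training sample. -/

section ScoreDeviation

variable {Z W : Type*} [MeasurableSpace Z] [MeasurableSpace W] (P : Measure Z)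
  [IsProbabilityMeasure P] {n : ℕ}

/-- The event that the empirical distribution function of the scores of a sample, for a score
depending on a parameter, exceeds the true one by more than `e` at a rational threshold. -/
def excessEvent (P : Measure Z) (n : ℕ) (S : W → Z → ℝ) (e : ℝ) : Set (W × (Fin n → Z)) :=
  {D | ∃ r : ℚ, n * (P.real {x | S D.1 x ≤ r} + e) < countLE (fun i => S D.1 (D.2 i)) r}

variable {S : W → Z → ℝ} {e : ℝ}

lemma measurableSet_excessEvent (hS : Measurable fun p : W × Z => S p.1 p.2) :
    MeasurableSet (excessEvent P n S e) := by
  have : excessEvent P n S e = ⋃ r : ℚ, {D : W × (Fin n → Z) |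
      n * (P.real {x | S D.1 x ≤ r} + e) < countLE (fun i => S D.1 (D.2 i)) r} := by
    ext D
    simp [excessEvent]
  rw [this]
  refine MeasurableSet.iUnion fun r => measurableSet_lt ?_ ?_
  · have h1 : Measurable fun w : W => P.real {x | S w x ≤ r} :=
      (measurable_measure_prodMk_left (ν := P)
        (measurableSet_le hS (measurable_const (a := (r : ℝ))))).ennreal_toReal
    exact ((h1.comp measurable_fst).add_const e).const_mul _
  · refine (measurable_countLE (r : ℝ)).comp (measurable_pi_lambda _ fun i => ?_)
    exact hS.comp (measurable_fst.prodMk ((measurable_pi_apply i).comp measurable_snd))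

/-- For a fixed parameter the scores are i.i.d. and the bound is free of their law; Fubini finishes.
-/
lemma measure_excessEvent_le (hS : Measurable fun p : W × Z => S p.1 p.2) (Q : Measure W) [IsProbabilityMeasure Q] (he : 0 < e) :
    (Q.prod (Measure.pi fun _ : Fin n => P)) (excessEvent P n S e)
      ≤ ENNReal.ofReal (Real.exp (-(2 * n * e ^ 2))) := by
  rw [Measure.prod_apply (measurableSet_excessEvent P hS)]
  have hw : ∀ w, (Measure.pi fun _ : Fin n => P) (Prod.mk w ⁻¹' excessEvent P n S e)
      ≤ ENNReal.ofReal (Real.exp (-(2 * n * e ^ 2))) := by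
    intro w
    have hSw : Measurable (S w) := hS.comp measurable_prodMk_left
    have : IsProbabilityMeasure (P.map (S w)) := Measure.isProbabilityMeasure_map hSw.aemeasurable
    have h := measure_empirical_cdf_le (P.map (S w)) n he
    rw [← Measure.pi_map_pi fun _ => hSw.aemeasurable] at h
    refine le_trans ?_ h
    refine le_trans (measure_mono ?_)
      (Measure.le_map_apply (measurable_pi_lambda _ fun i =>
        hSw.comp (measurable_pi_apply i)).aemeasurable _)
    rintro z ⟨r, hr⟩
    refine ⟨r, ?_⟩
    rw [map_measureReal_apply hSw measurableSet_Iic]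
    exact hr
  calc _ ≤ ∫⁻ _, ENNReal.ofReal (Real.exp (-(2 * n * e ^ 2))) ∂Q := lintegral_mono hw
    _ = _ := by simp

end ScoreDeviation

/-! ### Weighted labels against true labels. -/

section Comparison

variable {X : Type*} {n m c : ℕ}

/-- Label weights against the actual labels, for one instance. -/
lemma abs_sum_weights_sub_le {w g : Fin c → ℝ} (hw : ∀ y, 0 ≤ w y) (hw1 : ∑ y, w y = 1)
    (y₀ : Fin c) : |∑ y, w y * g y - g y₀| ≤ ∑ y, |g y| := by
  have h1 : g y₀ = ∑ y, (if y = y₀ then 1 else 0) * g y := by simp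
  rw [h1, ← Finset.sum_sub_distrib]
  refine (Finset.abs_sum_le_sum_abs _ _).trans (Finset.sum_le_sum fun y _ => ?_)
  rw [← sub_mul, abs_mul]
  refine mul_le_of_le_one_left (abs_nonneg _) (abs_le.2 ?_)
  have h2 : w y ≤ 1 := hw1 ▸ Finset.single_le_sum (fun y _ => hw y) (Finset.mem_univ y)
  have h3 := hw y
  split_ifs <;> constructor <;> linarith

/-- Replacing the indicator by `f` in the comparison of weighted with true labels. -/
lemma abs_weighted_sub_empirical_le {w : Fin n → Fin c → ℝ} (hw : IsLabelWeights w)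
    (z : Fin n → X × Fin c) (χ f : X × Fin c → ℝ) :
    |((1 / n : ℝ) * ∑ i, ∑ y, w i y * χ ((z i).1, y) - (1 / n : ℝ) * ∑ i, χ (z i))
      - ((1 / n : ℝ) * ∑ i, ∑ y, w i y * f ((z i).1, y) - (1 / n : ℝ) * ∑ i, f (z i))|
      ≤ (1 / n : ℝ) * ∑ i, ∑ y, |χ ((z i).1, y) - f ((z i).1, y)| := by
  have h : ((1 / n : ℝ) * ∑ i, ∑ y, w i y * χ ((z i).1, y) - (1 / n : ℝ) * ∑ i, χ (z i))
      - ((1 / n : ℝ) * ∑ i, ∑ y, w i y * f ((z i).1, y) - (1 / n : ℝ) * ∑ i, f (z i))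
      = (1 / n : ℝ) * ∑ i, (∑ y, w i y * (χ ((z i).1, y) - f ((z i).1, y))
          - (χ ((z i).1, (z i).2) - f ((z i).1, (z i).2))) := by
    simp only [mul_sub, Finset.sum_sub_distrib, Prod.mk.eta]
    ring
  rw [h, abs_mul, abs_of_nonneg (by positivity)]
  refine mul_le_mul_of_nonneg_left ?_ (by positivity)
  refine (Finset.abs_sum_le_sum_abs _ _).trans (Finset.sum_le_sum fun i _ => ?_)
  exact abs_sum_weights_sub_le (g := fun y => χ ((z i).1, y) - f ((z i).1, y)) (hw.1 i) (hw.2 i) _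

variable {F : Set (X × Fin c → ℝ)} {B V : ℝ}

/-- The real supremum dominates its members only if it is bounded. It is, by B, because each member
averages differences f(x_i, y) - f(z_j). -/
lemma abs_weighted_mean_sub_le_ipmObjective (hFB : ∀ f ∈ F, ∀ z z', |f z - f z'| ≤ B) (hn : 0 < n)
    (hm : 0 < m) (train : Fin m → X × Fin c) (x : Fin n → X) {w : Fin n → Fin c → ℝ}
    (hw : IsLabelWeights w) {f : X × Fin c → ℝ} (hf : f ∈ F) :
    |(1 / n : ℝ) * ∑ i, ∑ y, w i y * f (x i, y) - (1 / m : ℝ) * ∑ j, f (train j)|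
      ≤ ipmObjective F train x w := by
  have hn' : (n : ℝ) ≠ 0 := by positivity
  have hm' : (m : ℝ) ≠ 0 := by positivity
  refine le_ciSup (f := fun f : F => |(1 / n : ℝ) * ∑ i, ∑ y, w i y * f.1 (x i, y)
    - (1 / m : ℝ) * ∑ j, f.1 (train j)|) ⟨B, ?_⟩ ⟨f, hf⟩
  rintro _ ⟨⟨f, hf⟩, rfl⟩
  have hcomb : (1 / n : ℝ) * ∑ i, ∑ y, w i y * f (x i, y) - (1 / m : ℝ) * ∑ j, f (train j)
      = (1 / n : ℝ) * ∑ i, ∑ y, w i y * ((1 / m : ℝ) * ∑ j, (f (x i, y) - f (train j))) := by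
    have hin : ∀ a : ℝ, (1 / m : ℝ) * ∑ j, (a - f (train j)) = a - (1 / m : ℝ) * ∑ j, f (train j) := by
      intro a
      rw [Finset.sum_sub_distrib, mul_sub]
      simp [hm']
    simp only [hin]
    simp only [mul_sub, Finset.sum_sub_distrib, ← Finset.sum_mul, hw.2]
    simp [hn']
  simp only [hcomb]
  rw [abs_mul, abs_of_nonneg (by positivity)]
  calc (1 / n : ℝ) * |∑ i, ∑ y, w i y * ((1 / m : ℝ) * ∑ j, (f (x i, y) - f (train j)))|
      ≤ (1 / n : ℝ) * ∑ i, ∑ y, w i y * ((1 / m : ℝ) * ∑ _j : Fin m, B) := by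
        gcongr
        refine (Finset.abs_sum_le_sum_abs _ _).trans (Finset.sum_le_sum fun i _ => ?_)
        refine (Finset.abs_sum_le_sum_abs _ _).trans (Finset.sum_le_sum fun y _ => ?_)
        rw [abs_mul, abs_mul, abs_of_nonneg (hw.1 i y),
          abs_of_nonneg (by positivity : (0 : ℝ) ≤ 1 / m)]
        refine mul_le_mul_of_nonneg_left ?_ (hw.1 i y)
        refine mul_le_mul_of_nonneg_left ?_ (by positivity)
        exact (Finset.abs_sum_le_sum_abs _ _).trans
          (Finset.sum_le_sum fun j _ => hFB f hf _ _)
    _ = B := by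
        simp only [← Finset.sum_mul, hw.2, Finset.sum_const, Finset.card_univ, Fintype.card_fin,
          nsmul_eq_mul]
        field_simp

lemma mean_sub_mean_le_meanGap {Z : Type*} {F : Set (Z → ℝ)}
    (hFB : ∀ f ∈ F, ∀ z z', |f z - f z'| ≤ B) (hm : 0 < m) (hn : 0 < n) {f : Z → ℝ} (hf : f ∈ F)
    (x : Fin m → Z) (y : Fin n → Z) :
    (1 / m : ℝ) * ∑ j, f (x j) - (1 / n : ℝ) * ∑ i, f (y i) ≤ meanGap F (x, y) := by
  refine le_trans (le_of_eq ?_) (le_ciSup (bddAbove_meanGap hFB hm hn (x, y)) ⟨f, hf⟩)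
  rw [← Finset.mul_sum, ← Finset.mul_sum]
  ring

lemma weighted_sub_empirical_le (hFne : F.Nonempty) (hFB : ∀ f ∈ F, ∀ z z', |f z - f z'| ≤ B)
    (hn : 0 < n) (hm : 0 < m) {w : Fin n → Fin c → ℝ} (hw : IsLabelWeights w)
    (train : Fin m → X × Fin c) (z : Fin n → X × Fin c) (χ : X × Fin c → ℝ)
    (hV : ipmObjective F train (fun i => (z i).1) w ≤ V) :
    (1 / n : ℝ) * ∑ i, ∑ y, w i y * χ ((z i).1, y) - (1 / n : ℝ) * ∑ i, χ (z i)
      ≤ V + approxError F (fun i => (z i).1) χ + meanGap F (train, z) := by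
  have : Nonempty F := hFne.to_subtype
  have h : (1 / n : ℝ) * ∑ i, ∑ y, w i y * χ ((z i).1, y) - (1 / n : ℝ) * ∑ i, χ (z i)
      - V - meanGap F (train, z) ≤ approxError F (fun i => (z i).1) χ := by
    refine le_ciInf fun f => ?_
    have h1 := (abs_le.1 (abs_weighted_sub_empirical_le hw z χ f.1)).2
    have h2 := (abs_le.1 ((abs_weighted_mean_sub_le_ipmObjective hFB hn hm train
      (fun i => (z i).1) hw f.2).trans hV)).2
    have h3 := mean_sub_mean_le_meanGap hFB hm hn f.2 train z
    linarith
  linarith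

lemma empirical_sub_weighted_le (hFne : F.Nonempty) (hFB : ∀ f ∈ F, ∀ z z', |f z - f z'| ≤ B)
    (hn : 0 < n) (hm : 0 < m) {w : Fin n → Fin c → ℝ} (hw : IsLabelWeights w)
    (train : Fin m → X × Fin c) (z : Fin n → X × Fin c) (χ : X × Fin c → ℝ)
    (hV : ipmObjective F train (fun i => (z i).1) w ≤ V) :
    (1 / n : ℝ) * ∑ i, χ (z i) - (1 / n : ℝ) * ∑ i, ∑ y, w i y * χ ((z i).1, y)
      ≤ V + approxError F (fun i => (z i).1) χ + meanGap F (z, train) := by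
  have : Nonempty F := hFne.to_subtype
  have h : (1 / n : ℝ) * ∑ i, χ (z i) - (1 / n : ℝ) * ∑ i, ∑ y, w i y * χ ((z i).1, y)
      - V - meanGap F (z, train) ≤ approxError F (fun i => (z i).1) χ := by
    refine le_ciInf fun f => ?_
    have h1 := (abs_le.1 (abs_weighted_sub_empirical_le hw z χ f.1)).1
    have h2 := (abs_le.1 ((abs_weighted_mean_sub_le_ipmObjective hFB hn hm train
      (fun i => (z i).1) hw f.2).trans hV)).1
    have h3 := mean_sub_mean_le_meanGap hFB hn hm f.2 z train
    linarith
  linarith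

variable {α : ℝ} {S : X × Fin c → ℝ} {x : Fin n → X} {w : Fin n → Fin c → ℝ}

lemma weighted_coverage_eq (α : ℝ) (S : X × Fin c → ℝ) (x : Fin n → X) (w : Fin n → Fin c → ℝ) :
    (1 / n : ℝ) * ∑ i, ∑ y, w i y * coverageIndicator (predictionSet α S x w) (x i, y)
      = ∑ p : Fin n × Fin c, w p.1 p.2 / n
        * (if (S (x p.1, p.2) : EReal) ≤ conformalQuantile α S x w then 1 else 0) := by
  rw [Fintype.sum_prod_type, Finset.mul_sum]
  refine Finset.sum_congr rfl fun i _ => ?_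
  rw [Finset.mul_sum]
  refine Finset.sum_congr rfl fun y _ => ?_
  have : coverageIndicator (predictionSet α S x w) (x i, y)
      = if (S (x i, y) : EReal) ≤ conformalQuantile α S x w then 1 else 0 := by
    unfold coverageIndicator predictionSet
    congr
  rw [this]
  ring

lemma sum_weights_div (hn : 0 < n) (hw : IsLabelWeights w) :
    ∑ p : Fin n × Fin c, w p.1 p.2 / n = 1 := by
  have hn' : (n : ℝ) ≠ 0 := by positivity
  rw [Fintype.sum_prod_type]
  simp only [← Finset.sum_div, hw.2]
  simp [hn']

/-- The level (1 - α)(1 + 1/n) may exceed 1 and be unattainable; the quantile is then `⊤` and the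
weighted coverage is 1. -/
lemma one_sub_le_weighted_coverage (hn : 0 < n) (hα0 : 0 ≤ α) (hα1 : α ≤ 1)
    (hw : IsLabelWeights w) : 1 - α ≤ (1 / n : ℝ)
      * ∑ i, ∑ y, w i y * coverageIndicator (predictionSet α S x w) (x i, y) := by
  rw [weighted_coverage_eq]
  by_cases hq : conformalQuantile α S x w = ⊤
  · rw [hq]
    simp only [le_top, if_true, mul_one]
    rw [sum_weights_div hn hw]
    linarith
  · refine le_trans ?_ (le_sum_quantile (fun p => div_nonneg (hw.1 _ _) (Nat.cast_nonneg _)) hq)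
    exact le_mul_of_one_le_right (by linarith) (by simp)

lemma weighted_coverage_le (hn : 0 < n) (hα1 : α ≤ 1)
    (hw : IsLabelWeights w) (hS : Function.Injective fun p : Fin n × Fin c => S (x p.1, p.2)) :
    (1 / n : ℝ) * ∑ i, ∑ y, w i y * coverageIndicator (predictionSet α S x w) (x i, y)
      ≤ 1 - α + 2 / (n + 1) := by
  have hn' : (0 : ℝ) < n := by exact_mod_cast hn
  have hp : ∀ p : Fin n × Fin c, 0 ≤ w p.1 p.2 / n :=
    fun p => div_nonneg (hw.1 _ _) (Nat.cast_nonneg _)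
  have hw1 : ∀ i y, w i y ≤ 1 := fun i y =>
    hw.2 i ▸ Finset.single_le_sum (fun y _ => hw.1 i y) (Finset.mem_univ y)
  rw [weighted_coverage_eq]
  -- For small α the bound is at least 1. Otherwise level plus one atom is 1 - α + (2 - α)/n, and (2
  -- - α)/n ≤ 2/(n + 1) is equivalent to α ≥ 2/(n + 1).
  rcases le_or_gt α (2 / (n + 1)) with hα | hα
  · calc _ ≤ ∑ p : Fin n × Fin c, w p.1 p.2 / n := Finset.sum_le_sum fun p _ =>
          mul_le_of_le_one_right (hp p) (by split_ifs <;> norm_num)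
      _ = 1 := sum_weights_div hn hw
      _ ≤ _ := by linarith
  · have hβ : 0 ≤ (1 - α) * (1 + 1 / (n : ℝ)) := mul_nonneg (by linarith) (by positivity)
    refine (sum_quantile_le (κ := 1 / n) hβ (by positivity) hp (fun p => ?_) hS).trans ?_
    · exact div_le_div_of_nonneg_right (hw1 _ _) hn'.le
    · have h1 : (1 - α) * (1 + 1 / (n : ℝ)) + 1 / n = 1 - α + (2 - α) / n := by
        field_simp
        ring
      have h2 : (2 - α) / n ≤ 2 / (n + 1) := by
        rw [div_lt_iff₀ (by positivity)] at hα
        rw [div_le_div_iff₀ hn' (by positivity)]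
        nlinarith
      linarith

lemma sum_coverageIndicator (z : Fin n → X × Fin c) :
    ∑ i, coverageIndicator (predictionSet α S x w) (z i)
      = ∑ i, if (S (z i) : EReal) ≤ conformalQuantile α S x w then 1 else 0 := by
  refine Finset.sum_congr rfl fun i _ => ?_
  unfold coverageIndicator predictionSet
  congr

end Comparison

/-! ### Assembling the two exceptional events. -/

section Assembly

variable {Ω : Type*} [MeasurableSpace Ω] {μ : Measure Ω} [IsProbabilityMeasure μ]

lemma withProbAtLeast_of_le {δ : ℝ} (hδ : 0 ≤ δ) {Q G : Ω → Prop} {E₁ E₂ : Set Ω}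
    (h₁ : MeasurableSet E₁) (h₂ : MeasurableSet E₂) (hE₁ : μ E₁ ≤ ENNReal.ofReal (δ / 2))
    (hE₂ : μ E₂ ≤ ENNReal.ofReal (δ / 2)) (hG : ∀ᵐ ω ∂μ, G ω)
    (h : ∀ ω, ω ∉ E₁ → ω ∉ E₂ → G ω → Q ω) : WithProbAtLeast μ (1 - δ) Q := by
  -- `G` need not be measurable (the weights and `V` are arbitrary functions), so its failure set is
  -- enclosed in a measurable null set.
  let N := toMeasurable μ {ω | ¬ G ω}
  have hN : μ N = 0 := by rw [measure_toMeasurable]; exact hG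
  have hm : MeasurableSet (E₁ ∪ E₂ ∪ N) := (h₁.union h₂).union (measurableSet_toMeasurable _ _)
  refine ⟨(E₁ ∪ E₂ ∪ N)ᶜ, hm.compl, ?_, fun ω hω => ?_⟩
  · rw [prob_compl_eq_one_sub hm, ENNReal.ofReal_sub _ hδ, ENNReal.ofReal_one]
    refine tsub_le_tsub_left ?_ _
    calc μ (E₁ ∪ E₂ ∪ N) ≤ μ E₁ + μ E₂ + μ N :=
          (measure_union_le _ _).trans (by gcongr; exact measure_union_le _ _)
      _ ≤ ENNReal.ofReal (δ / 2) + ENNReal.ofReal (δ / 2) + 0 := by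
          gcongr
          exact hN.le
      _ = ENNReal.ofReal δ := by
          rw [add_zero, ← ENNReal.ofReal_add (by positivity) (by positivity), add_halves]
  · simp only [Set.mem_compl_iff, Set.mem_union, not_or] at hω
    refine h ω hω.1.1 hω.1.2 ?_
    by_contra hGω
    exact hω.2 (subset_toMeasurable μ _ hGω)

lemma withProbAtLeast_of_forall {δ : ℝ} (hδ : 0 ≤ δ) {Q : Ω → Prop} (h : ∀ ω, Q ω) :
    WithProbAtLeast μ (1 - δ) Q := by
  refine ⟨Set.univ, MeasurableSet.univ, ?_, fun ω _ => h ω⟩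
  rw [measure_univ, ENNReal.ofReal_le_one]
  linarith

variable {X : Type*} [MeasurableSpace X] {n m c : ℕ} (P : Measure (X × Fin c))
  {F : Set (X × Fin c → ℝ)} {B δ V : ℝ} {x : Fin n → X} {C : X → Set (Fin c)}

lemma coverageGap_eq_coe (hRn : rademacher P F n ≠ ∞) (hRm : rademacher P F m ≠ ∞) :
    coverageGap P F m B δ V x C = ((V + approxError F x (coverageIndicator C)
      + B * √((1 / n + 1 / m) * (Real.log (2 / δ) / 2))
      + 2 * ((rademacher P F m).toReal + (rademacher P F n).toReal) : ℝ) : EReal) := by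
  have h : 2 * (rademacher P F n + rademacher P F m) ≠ ∞ :=
    ENNReal.mul_ne_top (by simp) (ENNReal.add_ne_top.2 ⟨hRn, hRm⟩)
  rw [coverageGap, ← EReal.coe_ennreal_toReal h, ← EReal.coe_add, ENNReal.toReal_mul,
    ENNReal.toReal_add hRn hRm, add_comm (rademacher P F n).toReal]
  simp

lemma coverageGap_eq_top (h : rademacher P F n = ∞ ∨ rademacher P F m = ∞) :
    coverageGap P F m B δ V x C = ⊤ := by
  have h' : 2 * (rademacher P F n + rademacher P F m) = ∞ := by
    rcases h with h | h <;> rw [h] <;> simp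
  rw [coverageGap, h', EReal.coe_ennreal_top, EReal.coe_add_top]

lemma coverage_predictionSet {w : Fin n → Fin c → ℝ} (α : ℝ) (S : X × Fin c → ℝ) :
    coverage P (predictionSet α S x w)
      = P.real {z | (S z : EReal) ≤ conformalQuantile α S x w} := rfl

variable [IsProbabilityMeasure P]

instance : IsProbabilityMeasure (dataLaw P m n) := by
  unfold dataLaw
  infer_instance

lemma exp_neg_two_mul_sq_sqrt (hn : 0 < n) (hδ0 : 0 < δ) (hδ1 : δ < 1) :
    Real.exp (-(2 * n * √(Real.log (2 / δ) / (2 * n)) ^ 2)) = δ / 2 := by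
  have hlog : 0 < Real.log (2 / δ) := Real.log_pos (by rw [lt_div_iff₀ hδ0]; linarith)
  have hn' : (0 : ℝ) < n := by exact_mod_cast hn
  rw [Real.sq_sqrt (by positivity), mul_div_cancel₀ _ (by positivity), ← Real.log_inv,
    Real.exp_log (by positivity), inv_div]

end Assembly

end UnsupCal

open UnsupCal in
/-- The score `S` is any measurable function of the training samples. The label weights `w` and
the bound `V` are any functions of the dataset (in particular, of the training samples and the
calibration instances only). -/
theorem theorem1 {X : Type*} [MeasurableSpace X] {n m c : ℕ} (hn : 0 < n) (hm : 0 < m)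
    (P : Measure (X × Fin c)) [IsProbabilityMeasure P]
    (α δ B : ℝ) (hα0 : 0 ≤ α) (hα1 : α ≤ 1) (hδ0 : 0 < δ) (hδ1 : δ < 1)
    (S : (Fin m → X × Fin c) → X × Fin c → ℝ)
    (hS : Measurable fun p : (Fin m → X × Fin c) × (X × Fin c) => S p.1 p.2)
    (F : Set (X × Fin c → ℝ)) (hFne : F.Nonempty) (hFmeas : UnsupCal.IsMeasurableClass F)
    (hFB : ∀ f ∈ F, ∀ z z', |f z - f z'| ≤ B)
    (w : (Fin m → X × Fin c) × (Fin n → X × Fin c) → Fin n → Fin c → ℝ)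
    (V : (Fin m → X × Fin c) × (Fin n → X × Fin c) → ℝ)
    (hw : ∀ᵐ D ∂(UnsupCal.dataLaw P m n), UnsupCal.IsLabelWeights (w D))
    (hV : ∀ᵐ D ∂(UnsupCal.dataLaw P m n),
      UnsupCal.ipmObjective F D.1 (fun i => (D.2 i).1) (w D) ≤ V D) :
    UnsupCal.WithProbAtLeast (UnsupCal.dataLaw P m n) (1 - δ) (fun D =>
      let x : Fin n → X := fun i => (D.2 i).1
      let C : X → Set (Fin c) := UnsupCal.predictionSet α (S D.1) x (w D)
      ((1 - α : ℝ) : EReal) - UnsupCal.coverageGap P F m B δ (V D) x C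
          - ((√(Real.log (2 / δ) / (2 * n)) : ℝ) : EReal)
        ≤ (UnsupCal.coverage P C : EReal)) ∧
    ((∀ᵐ D ∂(UnsupCal.dataLaw P m n),
        Function.Injective fun p : Fin n × Fin c => S D.1 ((D.2 p.1).1, p.2)) →
      UnsupCal.WithProbAtLeast (UnsupCal.dataLaw P m n) (1 - δ) (fun D =>
        let x : Fin n → X := fun i => (D.2 i).1
        let C : X → Set (Fin c) := UnsupCal.predictionSet α (S D.1) x (w D)
        (UnsupCal.coverage P C : EReal)
          ≤ ((1 - α + 2 / (n + 1) : ℝ) : EReal) + UnsupCal.coverageGap P F m B δ (V D) x C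
            + ((√(Real.log (2 / δ) / (2 * n)) : ℝ) : EReal))) := by
  -- With an infinite Rademacher complexity the gap is `⊤` and both bounds are void.
  by_cases hR : rademacher P F n = (⊤ : ENNReal) ∨ rademacher P F m = (⊤ : ENNReal)
  · constructor
    · refine withProbAtLeast_of_forall hδ0.le fun D => ?_
      simp only [coverageGap_eq_top P hR]
      simp
    · intro _
      refine withProbAtLeast_of_forall hδ0.le fun D => ?_
      simp only [coverageGap_eq_top P hR, EReal.coe_add_top, EReal.top_add_coe, le_top]
  rw [not_or] at hR
  obtain ⟨hRn, hRm⟩ := hR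
  have hn' : (0 : ℝ) < n := by exact_mod_cast hn
  have hlog : 0 < Real.log (2 / δ) := Real.log_pos (by rw [lt_div_iff₀ hδ0]; linarith)
  set e := √(Real.log (2 / δ) / (2 * n)) with he
  have he0 : 0 < e := Real.sqrt_pos.2 (by positivity)
  have hexp : Real.exp (-(2 * n * e ^ 2)) = δ / 2 := exp_neg_two_mul_sq_sqrt hn hδ0 hδ1
  set K := 2 * ((rademacher P F m).toReal + (rademacher P F n).toReal) with hK
  set b := B * √((1 / n + 1 / m) * (Real.log (2 / δ) / 2)) with hb
  have hSw : ∀ t, Measurable (S t) := fun t => hS.comp measurable_prodMk_left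
  constructor
  · have hE := measure_excessEvent_le P (n := n) hS (Measure.pi fun _ : Fin m => P) he0
    rw [hexp] at hE
    refine withProbAtLeast_of_le hδ0.le (measurableSet_excessEvent P hS)
      (measurableSet_lt measurable_const (measurable_linSup hFne hFmeas _ _)) hE
      (measure_meanGap_gt_le P hFne hFmeas hFB hm hn hRm hRn hδ0 hδ1) (hw.and hV) ?_
    rintro D hD₁ hD₂ ⟨hwD, hVD⟩
    dsimp only
    rw [coverageGap_eq_coe P hRn hRm, ← EReal.coe_sub, ← EReal.coe_sub, EReal.coe_le_coe_iff,
      coverage_predictionSet, ← hK, ← hb]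
    have h1 := one_sub_le_weighted_coverage (S := S D.1) (x := fun i => (D.2 i).1) hn hα0 hα1 hwD
    have h2 := weighted_sub_empirical_le hFne hFB hn hm hwD D.1 D.2
      (coverageIndicator (predictionSet α (S D.1) (fun i => (D.2 i).1) (w D))) hVD
    have h3 : meanGap F D ≤ K + b := not_lt.1 hD₂
    have h4 := count_le_of_rat P (hSw D.1) he0.le
      (fun r => not_lt.1 fun h => hD₁ ⟨r, h⟩)
      (conformalQuantile α (S D.1) (fun i => (D.2 i).1) (w D))
    rw [← sum_coverageIndicator] at h4
    have h5 := mul_le_mul_of_nonneg_left h4 (by positivity : (0 : ℝ) ≤ 1 / n)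
    rw [← mul_assoc, one_div_mul_cancel hn'.ne', one_mul] at h5
    linarith
  · intro hinj
    -- The upper bound needs the opposite tails: negated scores for the distribution function, and
    -- interchanged samples for the gap.
    have hS' : Measurable fun p : (Fin m → X × Fin c) × (X × Fin c) => -S p.1 p.2 := hS.neg
    have hE := measure_excessEvent_le P (n := n) (S := fun t z => -S t z) hS'
      (Measure.pi fun _ : Fin m => P) he0
    rw [hexp] at hE
    have hgap := measure_meanGap_gt_le P hFne hFmeas hFB hn hm hRn hRm hδ0 hδ1
    have hmeas : MeasurableSet {p : (Fin n → X × Fin c) × (Fin m → X × Fin c) |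
        2 * ((rademacher P F n).toReal + (rademacher P F m).toReal)
          + B * √((1 / m + 1 / n) * (Real.log (2 / δ) / 2)) < meanGap F p} :=
      measurableSet_lt measurable_const (measurable_linSup hFne hFmeas _ _)
    rw [← Measure.measurePreserving_swap.measure_preimage hmeas.nullMeasurableSet] at hgap
    refine withProbAtLeast_of_le hδ0.le (measurableSet_excessEvent P hS') (measurable_swap hmeas)
      hE hgap ((hw.and hV).and hinj) ?_
    rintro D hD₁ hD₂ ⟨⟨hwD, hVD⟩, hinjD⟩
    dsimp only
    rw [coverageGap_eq_coe P hRn hRm, ← EReal.coe_add, ← EReal.coe_add, EReal.coe_le_coe_iff,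
      coverage_predictionSet, ← hK, ← hb]
    have h1 := weighted_coverage_le (S := S D.1) (x := fun i => (D.2 i).1) hn hα1 hwD hinjD
    have h2 := empirical_sub_weighted_le hFne hFB hn hm hwD D.1 D.2
      (coverageIndicator (predictionSet α (S D.1) (fun i => (D.2 i).1) (w D))) hVD
    have h3 : meanGap F (D.2, D.1) ≤ K + b := by
      rw [hK, hb, add_comm (rademacher P F m).toReal, add_comm (1 / (n : ℝ))]
      exact not_lt.1 hD₂
    have h4 := le_count_of_rat P (hSw D.1) he0.le
      (fun r => not_lt.1 fun h => hD₁ ⟨r, h⟩)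
      (conformalQuantile α (S D.1) (fun i => (D.2 i).1) (w D))
    rw [← sum_coverageIndicator] at h4
    have h5 := mul_le_mul_of_nonneg_left h4 (by positivity : (0 : ℝ) ≤ 1 / n)
    rw [← mul_assoc, one_div_mul_cancel hn'.ne', one_mul] at h5
    linarith
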